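/- Let $k,t$ be positive integers, $n=kt$, and let $B_n$ be the Boolean lattice of all subsets of the $n$-element set $[k]\times[t]$, ordered by inclusion. Let $K$ be either the symmetric group $S_k$ or the alternating group $A_k$, and let $T\le S_t$ be generated by powers of disjoint cycles, i.e. $T=\langle\sigma_1^{e_1},\dots,\sigma_m^{e_m}\rangle$ with $\sigma_1,\dots,\sigma_m\in S_t$ pairwise disjoint cycles ($m\ge 0$, $e_i \geq 0$). Let $G=K\wr T$ be the wreath product, i.e. the group of all permutations of $[k]\times[t]$ of the form $(i,r)\mapsto(\rho_r(i),\tau(r))$ with $\rho_1,\dots,\rho_t\in K$ and $\tau\in T$, acting on $B_n$ by automorphisms $X\mapsto\phi(X)$. Then the quotient $B_n/G$ is a symmetric chain order. Here $B_n/G$ is the set of $G$-orbits on $B_n$, with $[x]\le[y]$ if $x'\le y'$ for some $x'\in[x]$, $y'\in[y]$. A finite ordered set $P$ is a symmetric chain order if it has a minimum element, all its maximal chains have the same length, and $P$ can be partitioned into symmetric chains: chains $x_1<\dots<x_s$ ($s\ge1$) such that no $z$ satisfies $x_i<z<x_{i+1}$ for any $i$, and $r(x_1)+r(x_s)=r(P)$,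 where $r(x)$ is the maximum of $|C|-1$ over chains $C\subseteq P$ with maximum element $x$, and $r(P)=\max_{x\in P}r(x)$. -/

import Mathlib

/-- The rank `r(x)`: the largest length (number of elements minus one) of a chain whose maximum
element is `x`. -/
noncomputable def posetRankAt {P : Type*} [PartialOrder P] (x : P) : ℕ∞ :=
  Order.height x

/-- The rank `r(P)`: the largest value of `r(x)` over all `x` in `P`. -/
noncomputable def posetRank (P : Type*) [PartialOrder P] : ℕ∞ :=
  ⨆ x : P, posetRankAt x

/-- A ranked order: a finite ordered set with a minimum element in which all maximal chains have
the same length. -/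
structure IsRankedOrder (P : Type*) [PartialOrder P] : Prop where
  finite : Finite P
  exists_min : ∃ m : P, ∀ x : P, m ≤ x
  maxChain_ncard_eq : ∀ C D : Set P,
    IsMaxChain (· ≤ ·) C → IsMaxChain (· ≤ ·) D → C.ncard = D.ncard

/-- A (nonempty) saturated chain `x₀ < x₁ < ⋯ < xₘ` with nothing strictly between consecutive
elements, which is symmetric: `r(x₀) + r(xₘ) = r(P)`. -/
def IsSymmetricChain {P : Type*} [PartialOrder P] (C : Set P) : Prop :=
  ∃ (m : ℕ) (x : Fin (m + 1) → P),
    Set.range x = C ∧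
    (∀ i : Fin m, x i.castSucc ⋖ x i.succ) ∧
    posetRankAt (x 0) + posetRankAt (x (Fin.last m)) = posetRank P

/-- A symmetric chain order: a ranked order that has a partition into symmetric chains. -/
def IsSymmetricChainOrder (P : Type*) [PartialOrder P] : Prop :=
  IsRankedOrder P ∧
    ∃ 𝒞 : Set (Set P), Setoid.IsPartition 𝒞 ∧ ∀ C ∈ 𝒞, IsSymmetricChain C

/-- The quotient `P/G`: the set of orbits of a group `G` of automorphisms of `P`. -/
def OrbitPoset {P : Type*} [PartialOrder P] (G : Subgroup (P ≃o P)) : Type _ :=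
  MulAction.orbitRel.Quotient G P

/-- The orbit `[x]` of `x` under `G`. -/
def OrbitPoset.mk {P : Type*} [PartialOrder P] (G : Subgroup (P ≃o P)) (x : P) : OrbitPoset G :=
  Quotient.mk (MulAction.orbitRel G P) x

theorem OrbitPoset.mk_eq_mk_iff {P : Type*} [PartialOrder P] {G : Subgroup (P ≃o P)} {x y : P} :
    OrbitPoset.mk G x = OrbitPoset.mk G y ↔ ∃ g ∈ G, g y = x := by
  have h : OrbitPoset.mk G x = OrbitPoset.mk G y ↔ x ∈ MulAction.orbit G y := Quotient.eq
  rw [h, MulAction.mem_orbit_iff]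
  exact ⟨fun ⟨g, hg⟩ => ⟨g.1, g.2, hg⟩, fun ⟨g, hg, h⟩ => ⟨⟨g, hg⟩, h⟩⟩

/-- An automorphism of a finite ordered set that moves `x` weakly up fixes `x`. -/
theorem OrderIso.eq_of_le_apply_of_finite {P : Type*} [PartialOrder P] [Finite P] (a : P ≃o P)
    {x : P} (h : x ≤ a x) : a x = x := by
  have : Finite (P ≃o P) := DFunLike.finite (P ≃o P)
  have hmono : ∀ n : ℕ, x ≤ (a ^ n) x := by
    intro n
    induction n with
    | zero => simp
    | succ n ih =>
      rw [pow_succ', RelIso.mul_apply]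
      exact h.trans (a.monotone ih)
  obtain ⟨n, hn, hpow⟩ := (isOfFinOrder_of_finite a).exists_pow_eq_one
  obtain ⟨m, rfl⟩ : ∃ m, n = m + 1 := ⟨n - 1, by omega⟩
  refine le_antisymm ?_ h
  have h1 : a x ≤ (a ^ (m + 1)) x := by
    rw [pow_succ', RelIso.mul_apply]
    exact a.monotone (hmono m)
  rw [hpow] at h1
  simpa using h1

/-- The order on `P/G`: `[x] ≤ [y]` if `x' ≤ y'` for some `x' ∈ [x]` and `y' ∈ [y]`. -/
instance OrbitPoset.instPartialOrder {P : Type*} [PartialOrder P] [Finite P]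
    (G : Subgroup (P ≃o P)) : PartialOrder (OrbitPoset G) where
  le a b := ∃ x y : P, OrbitPoset.mk G x = a ∧ OrbitPoset.mk G y = b ∧ x ≤ y
  le_refl a := by
    obtain ⟨x, rfl⟩ := Quotient.exists_rep a
    exact ⟨x, x, rfl, rfl, le_rfl⟩
  le_trans a b c := by
    rintro ⟨x, y, rfl, rfl, hxy⟩ ⟨y', z, hy, rfl, hyz⟩
    obtain ⟨g, hg, rfl⟩ := OrbitPoset.mk_eq_mk_iff.1 hy
    refine ⟨x, g⁻¹ z, rfl, ?_, ?_⟩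
    · exact OrbitPoset.mk_eq_mk_iff.2 ⟨g⁻¹, G.inv_mem hg, rfl⟩
    · refine hxy.trans ?_
      have := (g⁻¹).monotone hyz
      rwa [RelIso.inv_apply_self] at this
  le_antisymm a b := by
    rintro ⟨x, y, rfl, rfl, hxy⟩ ⟨y', x', hy, hx, hyx⟩
    obtain ⟨g, hg, rfl⟩ := OrbitPoset.mk_eq_mk_iff.1 hy
    obtain ⟨h, hh, rfl⟩ := OrbitPoset.mk_eq_mk_iff.1 hx
    -- here `x ≤ y` and `g y ≤ h x`
    have h1 : y ≤ (g⁻¹ * h) x := by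
      have := (g⁻¹).monotone hyx
      rwa [RelIso.inv_apply_self] at this
    have h2 := OrderIso.eq_of_le_apply_of_finite (g⁻¹ * h) (hxy.trans h1)
    rw [h2] at h1
    rw [le_antisymm hxy h1]

/-- The automorphism of the Boolean lattice of all subsets of a finite set `X` induced by a
permutation of `X`: it maps each subset to its image. -/
def booleanAut (X : Type*) : Equiv.Perm X →* (Finset X ≃o Finset X) where
  toFun φ :=
    { toEquiv := φ.finsetCongr
      map_rel_iff' := by intro s t; simp }
  map_one' := by
    ext s a
    change a ∈ s.map (Equiv.refl X).toEmbedding ↔ a ∈ s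
    simp
  map_mul' φ ψ := by
    ext s a
    change a ∈ s.map (ψ.trans φ).toEmbedding ↔ a ∈ (s.map ψ.toEmbedding).map φ.toEmbedding
    simp only [Finset.mem_map_equiv, Equiv.symm_trans_apply]

/-- The wreath product `K ≀ T` acting on `[k] × [t]`: all permutations of the form
`(i, r) ↦ (ρ r i, τ r)` with `ρ 1, …, ρ t` in `K` and `τ` in `T`. -/
def wreathSubgroup {k t : ℕ} (K : Subgroup (Equiv.Perm (Fin k)))
    (T : Subgroup (Equiv.Perm (Fin t))) : Subgroup (Equiv.Perm (Fin k × Fin t)) where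
  carrier := {φ | ∃ (ρ : Fin t → Equiv.Perm (Fin k)) (τ : Equiv.Perm (Fin t)),
    (∀ r, ρ r ∈ K) ∧ τ ∈ T ∧ ∀ i r, φ (i, r) = (ρ r i, τ r)}
  one_mem' := ⟨fun _ => 1, 1, fun _ => K.one_mem, T.one_mem, fun _ _ => rfl⟩
  mul_mem' := by
    rintro φ ψ ⟨ρ, τ, hρ, hτ, h⟩ ⟨ρ', τ', hρ', hτ', h'⟩
    refine ⟨fun r => ρ (τ' r) * ρ' r, τ * τ', fun r => K.mul_mem (hρ _) (hρ' _),
      T.mul_mem hτ hτ', fun i r => ?_⟩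
    rw [Equiv.Perm.mul_apply, h', h]
    rfl
  inv_mem' := by
    rintro φ ⟨ρ, τ, hρ, hτ, h⟩
    refine ⟨fun r => (ρ (τ⁻¹ r))⁻¹, τ⁻¹, fun r => K.inv_mem (hρ _), T.inv_mem hτ, fun i r => ?_⟩
    rw [Equiv.Perm.inv_eq_iff_eq, h]
    simp

/-- `T` is generated by powers `σ₁ ^ e₁, …, σₘ ^ eₘ` of pairwise disjoint cycles `σ₁, …, σₘ`. -/
def GeneratedByPowersOfDisjointCycles {X : Type*} (T : Subgroup (Equiv.Perm X)) : Prop :=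
  ∃ (m : ℕ) (σ : Fin m → Equiv.Perm X) (e : Fin m → ℕ),
    (∀ i, (σ i).IsCycle) ∧
    (∀ i j, i ≠ j → (σ i).Disjoint (σ j)) ∧
    T = Subgroup.closure (Set.range fun i => σ i ^ e i)

/-! The rank in `B_n/G` is cardinality, so it suffices to choose orbit representatives that split
into chains of centred rank `-m, -m+2, …, m` (`isSymmetricChainOrder_of_hasSymmChains`). Slicing a
subset of `[k] × [t]` into `t` subsets of `[k]` and replacing each slice by its representative
modulo `K` leaves functions from `[t]` to a set `A` with a symmetric chain decomposition, modulo `T`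
alone. Since `T` acts independently on the supports of the cycles, and powers of a cycle act freely
on its support, the problem becomes that of functions into `A` modulo a finite cyclic group `G`
acting freely; splitting the index set into orbits turns these into functions `G → Q` with `Q` a
power of `A`.

Recording which chain of `Q` each value lies in gives a word on `G`. The functions with a given word
form a box (a product of chains), to be taken modulo the stabiliser `H` of the word. So everything
rests on boxes modulo a subgroup that preserves the bounds (`boxHasSymmChains`), by induction on
`|G|`. If `H` is proper, it acts freely on `G` and the reduction above leads to boxes on the smaller
group `H`.

If `H = G`, the bound is a constant `q` (`boxHasSymmChains_const`). A cyclic word with letters `0,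
…, q`, other than the two constant words `0` and `q`, is cut into blocks `q, …, q, r, 0, …, 0`, each
determined by its sum. With the set `S` of block starts fixed, the sums range over a box with bound
`l * q - 2` at a block of length `l`; shifting the sums to start at `0` preserves centred rank. A
proper stabiliser of `S` falls under the previous case, and `S = G` gives the constant bound `q -
2`, so induction on `q` applies. The two constant words are attached to the ends of the chain of
rank `2 - |G| * q`. -/

/-- A transversal of the relation `s` on the set `A` that is a disjoint union of chains
`e i 0 ≤ ⋯ ≤ e i (m i)`, symmetric about zero with respect to the rank `ρ`. -/
def HasSymmChains {X : Type} [Preorder X] (ρ : X → ℤ) (s : X → X → Prop) (A : Set X) : Prop :=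
  ∃ (ι : Type) (m : ι → ℕ) (e : ι → ℕ → X),
    (∀ i j, j ≤ m i → e i j ∈ A) ∧
    (∀ i j, j ≤ m i → ρ (e i j) = 2 * j - m i) ∧
    (∀ i j j', j ≤ j' → j' ≤ m i → e i j ≤ e i j') ∧
    (∀ x ∈ A, ∃ i, ∃ j ≤ m i, s x (e i j)) ∧
    (∀ i j i' j', j ≤ m i → j' ≤ m i' → s (e i j) (e i' j') → i = i')

/-! ### Gluing, transporting and multiplying families of symmetric chains -/

namespace HasSymmChains

/-- The images of the pieces are mutually unrelated and cover `A` up to `s`, and on each piece `s`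
restricts to `s'`; hence the images of all chains together serve for `A`. -/
theorem glue {X : Type} [Preorder X] {ρ : X → ℤ} {s : X → X → Prop} {A : Set X}
    {α : Type} {Y : α → Type} [∀ a, Preorder (Y a)] {ρ' : ∀ a, Y a → ℤ}
    {s' : ∀ a, Y a → Y a → Prop} {B : ∀ a, Set (Y a)}
    (h : ∀ a, HasSymmChains (ρ' a) (s' a) (B a))
    (φ : ∀ a, Y a → X)
    (trans : ∀ x y z, s x y → s y z → s x z)
    (mem : ∀ a, ∀ y ∈ B a, φ a y ∈ A)
    (rank : ∀ a, ∀ y ∈ B a, ρ (φ a y) = ρ' a y)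
    (mono : ∀ a, ∀ y ∈ B a, ∀ y' ∈ B a, y ≤ y' → φ a y ≤ φ a y')
    (compat : ∀ a, ∀ y ∈ B a, ∀ y' ∈ B a, s' a y y' → s (φ a y) (φ a y'))
    (surj : ∀ x ∈ A, ∃ a, ∃ y ∈ B a, s x (φ a y))
    (inj : ∀ a b, ∀ y ∈ B a, ∀ y' ∈ B b, s (φ a y) (φ b y') → a = b)
    (inj' : ∀ a, ∀ y ∈ B a, ∀ y' ∈ B a, s (φ a y) (φ a y') → s' a y y') :
    HasSymmChains ρ s A := by
  choose ι m e he hρ hm hs hi using h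
  refine ⟨Σ a, ι a, fun p => m p.1 p.2, fun p j => φ p.1 (e p.1 p.2 j), ?_, ?_, ?_, ?_, ?_⟩
  · exact fun p j hj => mem _ _ (he _ _ _ hj)
  · exact fun p j hj => (rank _ _ (he _ _ _ hj)).trans (hρ _ _ _ hj)
  · exact fun p j j' hj hj' => mono _ _ (he _ _ _ (hj.trans hj')) _ (he _ _ _ hj')
      (hm _ _ _ _ hj hj')
  · intro x hx
    obtain ⟨a, y, hy, hxy⟩ := surj x hx
    obtain ⟨i, j, hj, hyj⟩ := hs a y hy
    exact ⟨⟨a, i⟩, j, hj, trans _ _ _ hxy (compat _ _ hy _ (he _ _ _ hj) hyj)⟩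
  · rintro ⟨a, i⟩ j ⟨b, i'⟩ j' hj hj' h
    obtain rfl := inj a b _ (he _ _ _ hj) _ (he _ _ _ hj') h
    rw [hi a i j i' j' hj hj' (inj' _ _ (he _ _ _ hj) _ (he _ _ _ hj') h)]

theorem map {X Y : Type} [Preorder X] [Preorder Y] {ρ : X → ℤ} {s : X → X → Prop} {A : Set X}
    {ρ' : Y → ℤ} {s' : Y → Y → Prop} {B : Set Y} (h : HasSymmChains ρ' s' B) (φ : Y → X)
    (trans : ∀ x y z, s x y → s y z → s x z)
    (mem : ∀ y ∈ B, φ y ∈ A)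
    (rank : ∀ y ∈ B, ρ (φ y) = ρ' y)
    (mono : ∀ y ∈ B, ∀ y' ∈ B, y ≤ y' → φ y ≤ φ y')
    (compat : ∀ y ∈ B, ∀ y' ∈ B, s' y y' → s (φ y) (φ y'))
    (surj : ∀ x ∈ A, ∃ y ∈ B, s x (φ y))
    (inj : ∀ y ∈ B, ∀ y' ∈ B, s (φ y) (φ y') → s' y y') :
    HasSymmChains ρ s A :=
  glue (α := Unit) (fun _ => h) (fun _ => φ) trans (fun _ => mem) (fun _ => rank)
    (fun _ => mono) (fun _ => compat) (fun x hx => ⟨(), surj x hx⟩) (fun _ _ _ _ _ _ _ => rfl)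
    (fun _ => inj)

theorem congr_rel {X : Type} [Preorder X] {ρ : X → ℤ} {s s' : X → X → Prop} {A : Set X}
    (h : HasSymmChains ρ s A) (hs : ∀ x y, s x y ↔ s' x y) : HasSymmChains ρ s' A := by
  rwa [← show s = s' from funext fun x => funext fun y => propext (hs x y)]

theorem Iic (n : ℕ) : HasSymmChains (fun x : ℕ => 2 * (x : ℤ) - n) Eq (Set.Iic n) :=
  ⟨Unit, fun _ => n, fun _ j => j, fun _ _ h => h, fun _ _ _ => rfl, fun _ _ _ h _ => h,
    fun x hx => ⟨(), x, hx, rfl⟩, fun _ _ _ _ _ _ _ => rfl⟩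

/-- The rectangle is cut into nested hooks: hook `i` runs from `(0, i)` to `(m - i, i)` and then up
to `(m - i, n)`. -/
theorem Iic_prod_Iic (m n : ℕ) :
    HasSymmChains (fun x : ℕ × ℕ => (2 * (x.1 : ℤ) - m) + (2 * (x.2 : ℤ) - n)) Eq
      (Set.Iic m ×ˢ Set.Iic n) := by
  refine ⟨Fin (min m n + 1), fun i => m + n - 2 * i,
    fun i j => if j ≤ m - i then (j, (i : ℕ)) else (m - i, i + (j - (m - i))), ?_, ?_, ?_, ?_, ?_⟩
  · intro i j hj
    have := i.2
    dsimp only at hj ⊢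
    split_ifs <;> simp only [Set.mem_prod, Set.mem_Iic] <;> omega
  · intro i j hj
    have := i.2
    dsimp only at hj ⊢
    split_ifs <;> simp only <;> omega
  · intro i j j' hj hj'
    have := i.2
    dsimp only at hj' ⊢
    split_ifs <;> simp only [Prod.mk_le_mk] <;> omega
  · rintro ⟨x, y⟩ ⟨hx, hy⟩
    simp only [Set.mem_Iic] at hx hy
    rcases le_or_gt (x + y) m with h | h
    · refine ⟨⟨y, by omega⟩, x, by dsimp only; omega, ?_⟩
      dsimp only
      rw [if_pos (by omega)]
    · refine ⟨⟨m - x, by omega⟩, x + (y - (m - x)), by dsimp only; omega, ?_⟩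
      dsimp only
      rw [if_neg (by omega), Prod.mk.injEq]
      omega
  · intro i j i' j' hj hj' h
    have := i.2
    have := i'.2
    ext
    dsimp only at h hj hj'
    split_ifs at h <;> simp only [Prod.mk.injEq] at h <;> omega

theorem prod {X Y : Type} [Preorder X] [Preorder Y] {ρ : X → ℤ} {A : Set X} {ρ' : Y → ℤ}
    {B : Set Y} (hA : HasSymmChains ρ Eq A) (hB : HasSymmChains ρ' Eq B) :
    HasSymmChains (fun x : X × Y => ρ x.1 + ρ' x.2) Eq (A ×ˢ B) := by
  obtain ⟨ι, m, e, he, hρ, hm, hs, hi⟩ := hA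
  obtain ⟨ι', m', e', he', hρ', hm', hs', hi'⟩ := hB
  have inj : ∀ a a' : ι × ι', ∀ y ∈ Set.Iic (m a.1) ×ˢ Set.Iic (m' a.2),
      ∀ y' ∈ Set.Iic (m a'.1) ×ˢ Set.Iic (m' a'.2),
      (e a.1 y.1, e' a.2 y.2) = (e a'.1 y'.1, e' a'.2 y'.2) → a = a' := by
    rintro ⟨a, b⟩ ⟨a', b'⟩ y hy y' hy' h
    rw [Prod.mk.injEq] at h
    exact Prod.ext (hi _ _ _ _ hy.1 hy'.1 h.1) (hi' _ _ _ _ hy.2 hy'.2 h.2)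
  refine glue (α := ι × ι') (fun a => Iic_prod_Iic (m a.1) (m' a.2))
    (fun a y => (e a.1 y.1, e' a.2 y.2)) (fun _ _ _ => Eq.trans) ?_ ?_ ?_ ?_ ?_ inj ?_
  · exact fun a y hy => ⟨he _ _ hy.1, he' _ _ hy.2⟩
  · intro a y hy
    dsimp only
    rw [hρ _ _ hy.1, hρ' _ _ hy.2]
  · exact fun a y hy y' hy' h => ⟨hm _ _ _ h.1 hy'.1, hm' _ _ _ h.2 hy'.2⟩
  · rintro a y - y' - rfl
    rfl
  · rintro ⟨x, y⟩ ⟨hx, hy⟩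
    obtain ⟨i, j, hj, rfl⟩ := hs x hx
    obtain ⟨i', j', hj', rfl⟩ := hs' y hy
    exact ⟨(i, i'), (j, j'), ⟨hj, hj'⟩, rfl⟩
  · intro a y hy y' hy' h
    rw [Prod.mk.injEq] at h
    have h1 := hρ _ _ hy.1
    have h2 := hρ' _ _ hy.2
    rw [h.1, hρ _ _ hy'.1] at h1
    rw [h.2, hρ' _ _ hy'.2] at h2
    ext <;> omega

/-- Pinning the coordinates outside `t` at `0` keeps the ambient type fixed, so that factors can be
added one at a time. -/
theorem box_finset {I : Type} [DecidableEq I] (m : I → ℕ) (t : Finset I) :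
    HasSymmChains (fun f : I → ℕ => ∑ i ∈ t, (2 * (f i : ℤ) - m i)) Eq
      {f | (∀ i ∈ t, f i ≤ m i) ∧ ∀ i ∉ t, f i = 0} := by
  induction t using Finset.induction_on with
  | empty =>
    refine ⟨Unit, fun _ => 0, fun _ _ => 0, ?_, ?_, ?_, ?_, ?_⟩
    · simp
    · simp
    · simp
    · intro x hx
      exact ⟨(), 0, le_rfl, funext fun i => hx.2 i (by simp)⟩
    · simp
  | insert a t ha ih =>
    have upd : ∀ (x : ℕ) (f : I → ℕ), ∀ i ∈ t, Function.update f a x i = f i := fun x f i hi =>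
      Function.update_of_ne (by rintro rfl; exact ha hi) _ _
    refine map ((Iic (m a)).prod ih) (fun p => Function.update p.2 a p.1)
      (fun _ _ _ => Eq.trans) ?_ ?_ ?_ ?_ ?_ ?_
    · rintro ⟨x, f⟩ ⟨hx, hf⟩
      refine ⟨fun i hi => ?_, fun i hi => ?_⟩
      · rcases Finset.mem_insert.1 hi with rfl | hi
        · simpa using hx
        · dsimp only
          rw [upd _ _ _ hi]
          exact hf.1 i hi
      · rw [Finset.mem_insert, not_or] at hi
        dsimp only
        rw [Function.update_of_ne hi.1]
        exact hf.2 i hi.2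
    · rintro ⟨x, f⟩ -
      dsimp only
      rw [Finset.sum_insert ha, Function.update_self,
        Finset.sum_congr rfl fun i hi => by rw [upd x f i hi]]
    · rintro ⟨x, f⟩ - ⟨x', f'⟩ - h
      exact update_le_update_iff.2 ⟨h.1, fun i _ => h.2 i⟩
    · rintro _ - _ - rfl
      rfl
    · intro f hf
      refine ⟨(f a, Function.update f a 0), ⟨hf.1 a (by simp), ?_, ?_⟩, by simp⟩
      · intro i hi
        dsimp only
        rw [upd _ _ _ hi]
        exact hf.1 i (by simp [hi])
      · intro i hi
        rcases eq_or_ne i a with rfl | h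
        · simp
        · dsimp only
          rw [Function.update_of_ne h]
          exact hf.2 i (by simp [h, hi])
    · rintro ⟨x, f⟩ ⟨-, hf⟩ ⟨x', f'⟩ ⟨-, hf'⟩ h
      have h0 := congrFun h a
      simp only [Function.update_self] at h0
      refine Prod.ext h0 (funext fun i => ?_)
      rcases eq_or_ne i a with rfl | hi
      · exact (hf.2 i ha).trans (hf'.2 i ha).symm
      · simpa [hi] using congrFun h i

theorem box_eq {I : Type} [Fintype I] (m : I → ℕ) :
    HasSymmChains (fun f : I → ℕ => ∑ i, (2 * (f i : ℤ) - m i)) Eq {f | ∀ i, f i ≤ m i} := by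
  classical
  simpa using box_finset m Finset.univ

/-- One chain in each factor spans a box; these boxes are glued. Since related elements have equal
rank, the position on a chain is recovered from the relation. -/
theorem pi {I : Type} [Fintype I] {X : I → Type} [∀ i, Preorder (X i)] {ρ : ∀ i, X i → ℤ}
    {s : ∀ i, X i → X i → Prop} {A : ∀ i, Set (X i)}
    (h : ∀ i, HasSymmChains (ρ i) (s i) (A i))
    (equiv : ∀ i, Equivalence (s i))
    (inv : ∀ i x y, s i x y → ρ i x = ρ i y) :
    HasSymmChains (fun f : ∀ i, X i => ∑ i, ρ i (f i)) (fun f f' => ∀ i, s i (f i) (f' i))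
      {f | ∀ i, f i ∈ A i} := by
  choose ι m e he hρ hm hs hi using h
  have inj : ∀ a a' : (∀ i, ι i), ∀ y ∈ {f : I → ℕ | ∀ i, f i ≤ m i (a i)},
      ∀ y' ∈ {f : I → ℕ | ∀ i, f i ≤ m i (a' i)},
      (∀ i, s i (e i (a i) (y i)) (e i (a' i) (y' i))) → a = a' :=
    fun a a' y hy y' hy' h => funext fun i => hi i _ _ _ _ (hy i) (hy' i) (h i)
  refine glue (α := ∀ i, ι i) (fun a => box_eq fun i => m i (a i))
    (fun a y i => e i (a i) (y i)) (fun x y z h h' i => (equiv i).trans (h i) (h' i))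
    ?_ ?_ ?_ ?_ ?_ inj ?_
  · exact fun a y hy i => he _ _ _ (hy i)
  · exact fun a y hy => Finset.sum_congr rfl fun i _ => hρ _ _ _ (hy i)
  · exact fun a y hy y' hy' h i => hm _ _ _ _ (h i) (hy' i)
  · rintro a y - _ - rfl i
    exact (equiv i).refl _
  · intro x hx
    choose a y hy h using fun i => hs i (x i) (hx i)
    exact ⟨a, y, hy, h⟩
  · intro a y hy y' hy' h
    funext i
    have h1 := inv i _ _ (h i)
    rw [hρ _ _ _ (hy i), hρ _ _ _ (hy' i)] at h1
    omega

end HasSymmChains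

/-! ### Functions modulo a group action, reduced to boxes -/

/-- Two functions on `I` are related if one is a translate of the other under the action of `G`. -/
def ShiftRel (G : Type) {I P : Type} [SMul G I] (f f' : I → P) : Prop :=
  ∃ g : G, ∀ i, f' i = f (g • i)

theorem ShiftRel.equivalence (G : Type) {I P : Type} [Group G] [MulAction G I] :
    Equivalence (ShiftRel G : (I → P) → (I → P) → Prop) where
  refl f := ⟨1, fun i => by rw [one_smul]⟩
  symm := by
    rintro f f' ⟨g, h⟩
    exact ⟨g⁻¹, fun i => by rw [h, smul_inv_smul]⟩
  trans := by
    rintro f f' f'' ⟨g, h⟩ ⟨g', h'⟩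
    exact ⟨g * g', fun i => by rw [h', h, mul_smul]⟩

/-- The subgroup of the translations that fix a function on a group. -/
def periodSubgroup {G Λ : Type} [Group G] (w : G → Λ) : Subgroup G where
  carrier := {h | ∀ x, w (h * x) = w x}
  one_mem' x := by rw [one_mul]
  mul_mem' {a b} ha hb x := by rw [mul_assoc, ha, hb]
  inv_mem' {a} ha x := by rw [← ha, mul_inv_cancel_left]

/-- The multisets on `I` with multiplicities bounded by `m`, modulo the action of `G`, have a
decomposition into symmetric chains. -/
def BoxHasSymmChains (G : Type) {I : Type} [Fintype I] [SMul G I] (m : I → ℕ) : Prop :=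
  HasSymmChains (fun f : I → ℕ => ∑ i, (2 * (f i : ℤ) - m i)) (ShiftRel G) {f | ∀ i, f i ≤ m i}

namespace HasSymmChains

/-- Each function has a well-defined label word `w`, compatible with translation. One word per orbit
is enough, and a translation relating two functions over the same word must fix that word. This is
why only `periodSubgroup w` acts on the fibre. -/
theorem shift_glue {G P Λ : Type} [CommGroup G] [Fintype G] [Preorder P] {ρ : (G → P) → ℤ}
    {A : Set (G → P)} (L : Set (G → Λ)) (M : (G → Λ) → (G → ℕ))
    (φ : (G → Λ) → (G → ℕ) → (G → P))
    (hL : ∀ w ∈ L, ∀ h : G, (fun x => w (h * x)) ∈ L)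
    (hM : ∀ w ∈ L, ∀ h x : G, M (fun x => w (h * x)) x = M w (h * x))
    (hφ : ∀ w ∈ L, ∀ h : G, ∀ f, (∀ x, f x ≤ M w x) →
      φ (fun x => w (h * x)) (fun x => f (h * x)) = fun x => φ w f (h * x))
    (box : ∀ w ∈ L, BoxHasSymmChains (periodSubgroup w) (M w))
    (mem : ∀ w ∈ L, ∀ f, (∀ x, f x ≤ M w x) → φ w f ∈ A)
    (rank : ∀ w ∈ L, ∀ f, (∀ x, f x ≤ M w x) → ρ (φ w f) = ∑ x, (2 * (f x : ℤ) - M w x))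
    (mono : ∀ w ∈ L, ∀ f, (∀ x, f x ≤ M w x) → ∀ f', (∀ x, f' x ≤ M w x) → f ≤ f' →
      φ w f ≤ φ w f')
    (surj : ∀ y ∈ A, ∃ w ∈ L, ∃ f, (∀ x, f x ≤ M w x) ∧ φ w f = y)
    (inj : ∀ w ∈ L, ∀ f, (∀ x, f x ≤ M w x) → ∀ w' ∈ L, ∀ f', (∀ x, f' x ≤ M w' x) →
      φ w f = φ w' f' → w = w' ∧ f = f') :
    HasSymmChains ρ (ShiftRel G) A := by
  let S : Setoid (G → Λ) := ⟨ShiftRel G, ShiftRel.equivalence G⟩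
  have key : ∀ w ∈ L, ∀ f, (∀ x, f x ≤ M w x) → ∀ w' ∈ L, ∀ f', (∀ x, f' x ≤ M w' x) → ∀ h : G,
      (∀ x, φ w' f' x = φ w f (h • x)) → (∀ x, w' x = w (h * x)) ∧ ∀ x, f' x = f (h * x) := by
    intro w hw f hf w' hw' f' hf' h heq
    have := inj w' hw' f' hf' (fun x => w (h * x)) (hL w hw h) (fun x => f (h * x))
      (fun x => by rw [hM w hw]; exact hf _) (by rw [hφ w hw h f hf]; exact funext heq)
    exact ⟨fun x => congrFun this.1 x, fun x => congrFun this.2 x⟩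
  -- The words equal to the chosen representative of their own orbit index the pieces.
  refine glue (α := {w : G → Λ // w ∈ L ∧ Quotient.out (Quotient.mk S w) = w})
    (fun w => box w.1 w.2.1) (fun w => φ w.1) (fun _ _ _ => (ShiftRel.equivalence G).trans)
    (fun w => mem w.1 w.2.1) (fun w => rank w.1 w.2.1) (fun w => mono w.1 w.2.1) ?_ ?_ ?_ ?_
  · rintro ⟨w, hw, hw1⟩ f hf f' hf' ⟨⟨h, hh⟩, hff'⟩
    refine ⟨h, fun x => ?_⟩
    have e1 : (fun x => w (h * x)) = w := funext hh
    have e2 : f' = fun x => f (h * x) := funext hff'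
    have := congrFun (hφ w hw h f hf) x
    rw [e1, ← e2] at this
    exact this
  · intro y hy
    obtain ⟨w, hw, f, hf, rfl⟩ := surj y hy
    obtain ⟨h, hh⟩ : ShiftRel G w (Quotient.out (Quotient.mk S w)) :=
      (ShiftRel.equivalence G).symm (Quotient.mk_out (s := S) w)
    have e : Quotient.out (Quotient.mk S w) = fun x => w (h * x) := funext hh
    refine ⟨⟨Quotient.out (Quotient.mk S w), by rw [e]; exact hL w hw h, by
      rw [Quotient.out_eq]⟩, fun x => f (h * x), ?_, h, ?_⟩
    · intro x
      dsimp only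
      rw [e, hM w hw]
      exact hf _
    · intro x
      dsimp only
      rw [e, hφ w hw h f hf]
      rfl
  · rintro ⟨w, hw, hw1⟩ ⟨w', hw', hw1'⟩ f hf f' hf' ⟨h, hh⟩
    have h1 := (key w hw f hf w' hw' f' hf' h hh).1
    have h2 : Quotient.mk S w = Quotient.mk S w' := Quotient.sound (s := S) ⟨h, h1⟩
    exact Subtype.ext (hw1.symm.trans ((congrArg Quotient.out h2).trans hw1'))
  · rintro ⟨w, hw, hw1⟩ f hf f' hf' ⟨h, hh⟩
    have h1 := key w hw f hf w hw f' hf' h hh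
    exact ⟨⟨h, fun x => (h1.1 x).symm⟩, h1.2⟩

theorem power_of_box {G P : Type} [CommGroup G] [Fintype G] [Preorder P] {ρ : P → ℤ} {A : Set P}
    (box : ∀ (H : Subgroup G) (m : G → ℕ), (∀ h ∈ H, ∀ x, m (h * x) = m x) →
      BoxHasSymmChains H m)
    (hA : HasSymmChains ρ Eq A) :
    HasSymmChains (fun f : G → P => ∑ x, ρ (f x)) (ShiftRel G) {f | ∀ x, f x ∈ A} := by
  obtain ⟨ι, m, e, he, hρ, hm, hs, hi⟩ := hA
  refine shift_glue (Λ := ι) Set.univ (fun w x => m (w x)) (fun w f x => e (w x) (f x))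
    (fun _ _ _ => trivial) (fun _ _ _ _ => rfl) (fun _ _ _ _ _ => rfl) ?_ ?_ ?_ ?_ ?_ ?_
  · exact fun w _ => box _ _ fun h hh x => congrArg m (hh x)
  · exact fun w _ f hf x => he _ _ (hf x)
  · exact fun w _ f hf => Finset.sum_congr rfl fun x _ => hρ _ _ (hf x)
  · exact fun w _ f hf f' hf' h x => hm _ _ _ (h x) (hf' x)
  · intro y hy
    choose w f hf h using fun x => hs (y x) (hy x)
    exact ⟨w, trivial, f, hf, funext fun x => (h x).symm⟩
  · intro w _ f hf w' _ f' hf' h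
    have h1 : w = w' := funext fun x => hi _ _ _ _ (hf x) (hf' x) (congrFun h x)
    subst h1
    refine ⟨rfl, funext fun x => ?_⟩
    have h2 := hρ _ _ (hf x)
    rw [congrFun h x, hρ _ _ (hf' x)] at h2
    omega

/-- Functions on a set with a free action of `G`, provided powers indexed by `G` are
understood. -/
theorem free_of_power {G I P : Type} [CommGroup G] [Fintype G] [Fintype I] [MulAction G I]
    [Preorder P] {ρ : I → P → ℤ} {A : I → Set P}
    (power : ∀ {Q : Type} [Preorder Q] {ρ : Q → ℤ} {A : Set Q}, HasSymmChains ρ Eq A →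
      HasSymmChains (fun f : G → Q => ∑ x, ρ (f x)) (ShiftRel G) {f | ∀ x, f x ∈ A})
    (free : ∀ (g : G) (i : I), g • i = i → g = 1)
    (hρ : ∀ (g : G) (i : I), ρ (g • i) = ρ i)
    (hinv : ∀ (g : G) (i : I), A (g • i) = A i)
    (hA : ∀ i, HasSymmChains (ρ i) Eq (A i)) :
    HasSymmChains (fun f : I → P => ∑ i, ρ i (f i)) (ShiftRel G) {f | ∀ i, f i ∈ A i} := by
  classical
  let Ω := MulAction.orbitRel.Quotient G I
  have : Fintype Ω := Fintype.ofFinite Ω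
  let o : Ω → I := Quotient.out
  -- By freeness the translation `c i` from the orbit representative to `i` is unique, so `I` is
  -- identified equivariantly with `G × Ω`.
  have hex : ∀ i : I, ∃ g : G, g • o (Quotient.mk _ i) = i := fun i =>
    (MulAction.orbitRel G I).symm (Quotient.mk_out i)
  choose c hc using hex
  have hmk : ∀ (g : G) (i : I),
      (Quotient.mk _ (g • i) : Ω) = Quotient.mk _ i := fun g i =>
    Quotient.sound ⟨g, rfl⟩
  have hcancel : ∀ (g g' : G) (i : I), g • i = g' • i → g = g' := fun g g' i h => by
    have := free (g'⁻¹ * g) i (by rw [mul_smul, h, inv_smul_smul])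
    rwa [inv_mul_eq_one, eq_comm] at this
  have hcs : ∀ (g : G) (i : I), c (g • i) = g * c i := fun g i => by
    refine hcancel _ _ (o (Quotient.mk _ i)) ?_
    rw [mul_smul, hc i]
    have := hc (g • i)
    rwa [hmk] at this
  have hco : ∀ ω : Ω, c (o ω) = 1 := fun ω => by
    refine hcancel _ _ (o ω) ?_
    have := hc (o ω)
    rw [show (Quotient.mk _ (o ω) : Ω) = ω from Quotient.out_eq ω] at this
    rw [this, one_smul]
  have hmo : ∀ (g : G) (ω : Ω), (Quotient.mk _ (g • o ω) : Ω) = ω := fun g ω => by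
    rw [hmk]
    exact Quotient.out_eq ω
  have hcmo : ∀ (g : G) (ω : Ω), c (g • o ω) = g := fun g ω => by
    rw [hcs, hco, mul_one]
  -- A function on `G × Ω` is read as a function on `G` whose values are functions on `Ω`.
  have hpi := power ((pi (fun ω : Ω => hA (o ω)) (fun _ => eq_equivalence)
    (fun _ _ _ h => by rw [h])).congr_rel fun _ _ => funext_iff.symm)
  have hA' : ∀ i, A (o (Quotient.mk _ i)) = A i := fun i => by
    conv_rhs => rw [← hc i]
    rw [hinv]
  have hρ' : ∀ i, ρ (o (Quotient.mk _ i)) = ρ i := fun i => by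
    conv_rhs => rw [← hc i]
    rw [hρ]
  refine map hpi (fun F i => F (c i) (Quotient.mk _ i)) (fun _ _ _ =>
    (ShiftRel.equivalence G).trans) ?_ ?_ ?_ ?_ ?_ ?_
  · intro F hF i
    have := hF (c i) (Quotient.mk _ i)
    rwa [hA'] at this
  · intro F _
    rw [← Fintype.sum_prod_type' (f := fun g ω => ρ (o ω) (F g ω))]
    refine Fintype.sum_equiv ⟨fun i => (c i, Quotient.mk _ i), fun p => p.1 • o p.2, hc, ?_⟩ _ _ ?_
    · exact fun p => Prod.ext (hcmo _ _) (hmo _ _)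
    · intro i
      dsimp only [Equiv.coe_fn_mk]
      rw [hρ']
  · exact fun F _ F' _ h i => h _ _
  · rintro F - F' - ⟨g, h⟩
    refine ⟨g, fun i => ?_⟩
    dsimp only
    rw [h, hcs, hmk]
    rfl
  · intro y hy
    refine ⟨fun g ω => y (g • o ω), fun g ω => ?_, 1, fun i => ?_⟩
    · have := hy (g • o ω)
      rwa [hinv] at this
    · dsimp only
      rw [one_smul, hc]
  · rintro F - F' - ⟨g, h⟩
    refine ⟨g, fun x => funext fun ω => ?_⟩
    have := h (x • o ω)
    have e1 : c (g • x • o ω) = g * x := by rw [hcs, hcmo]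
    have e2 : (Quotient.mk _ (g • x • o ω) : Ω) = ω := by rw [hmk, hmo]
    dsimp only at this
    rwa [e1, e2, hcmo, hmo] at this

end HasSymmChains

/-! ### Cutting a cyclic group into blocks -/

/-- The number of multiplications by `γ` needed to move `g` into `S`. -/
noncomputable def stepsTo {G : Type} [Group G] (γ : G) (S : G → Prop) (g : G) : ℕ :=
  sInf {i : ℕ | S (γ ^ i * g)}

/-- The length of the block `b, γ * b, γ ^ 2 * b, …` that ends before the next element of `S`. -/
noncomputable def blockLength {G : Type} [Group G] (γ : G) (S : G → Prop) (b : G) : ℕ :=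
  stepsTo γ S (γ * b) + 1

/-- The first element of the block of `g`. -/
noncomputable def blockStart {G : Type} [Group G] (γ : G) (S : G → Prop) (g : G) : G :=
  γ⁻¹ ^ stepsTo γ⁻¹ S g * g

section Blocks

variable {G : Type} [CommGroup G] {γ : G} {S : G → Prop}

theorem stepsTo_shift (γ : G) (S : G → Prop) (h x : G) :
    stepsTo γ (fun x => S (h * x)) x = stepsTo γ S (h * x) := by
  simp only [stepsTo, mul_left_comm]

theorem blockLength_shift (γ : G) (S : G → Prop) (h x : G) :
    blockLength γ (fun x => S (h * x)) x = blockLength γ S (h * x) := by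
  simp only [blockLength, stepsTo_shift, mul_left_comm]

theorem blockStart_shift (γ : G) (S : G → Prop) (h x : G) :
    h * blockStart γ (fun x => S (h * x)) x = blockStart γ S (h * x) := by
  simp only [blockStart, stepsTo_shift, mul_left_comm]

theorem stepsTo_le {i : ℕ} {g : G} (h : S (γ ^ i * g)) : stepsTo γ S g ≤ i := Nat.sInf_le h

theorem stepsTo_spec (hγ : ∀ g : G, ∃ n : ℕ, γ ^ n = g) (hS : ∃ g, S g) (g : G) :
    S (γ ^ stepsTo γ S g * g) := by
  obtain ⟨s, hs⟩ := hS
  obtain ⟨n, hn⟩ := hγ (s * g⁻¹)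
  exact Nat.sInf_mem (s := {i : ℕ | S (γ ^ i * g)}) ⟨n, by simpa [hn] using hs⟩

theorem exists_inv_pow [Finite G] (hγ : ∀ g : G, ∃ n : ℕ, γ ^ n = g) (g : G) :
    ∃ n : ℕ, γ⁻¹ ^ n = g := by
  obtain ⟨n, hn⟩ := hγ g⁻¹
  exact ⟨n, by rw [inv_pow, hn, inv_inv]⟩

theorem inv_pow_mul_pow {i j : ℕ} (h : i ≤ j) (b : G) :
    γ⁻¹ ^ i * (γ ^ j * b) = γ ^ (j - i) * b := by
  rw [← mul_assoc, inv_pow, ← inv_mul_eq_iff_eq_mul.2 (pow_mul_pow_sub γ h).symm]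

theorem not_of_lt_blockLength {b : G} {i : ℕ} (h0 : 0 < i) (hi : i < blockLength γ S b) :
    ¬ S (γ ^ i * b) := fun h => by
  obtain ⟨i, rfl⟩ : ∃ k, i = k + 1 := ⟨i - 1, by omega⟩
  rw [pow_succ, mul_assoc] at h
  have := stepsTo_le h
  rw [blockLength] at hi
  omega

theorem stepsTo_inv_pow_mul {b : G} (hb : S b) {i : ℕ} (hi : i < blockLength γ S b) :
    stepsTo γ⁻¹ S (γ ^ i * b) = i := by
  refine le_antisymm (stepsTo_le (by simpa using hb)) (le_of_not_gt fun h => ?_)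
  have hmem := Nat.sInf_mem (s := {k : ℕ | S (γ⁻¹ ^ k * (γ ^ i * b))}) ⟨i, by simpa using hb⟩
  change S (γ⁻¹ ^ stepsTo γ⁻¹ S (γ ^ i * b) * (γ ^ i * b)) at hmem
  rw [inv_pow_mul_pow h.le] at hmem
  exact not_of_lt_blockLength (by omega) (by omega) hmem

theorem blockStart_pow_mul {b : G} (hb : S b) {i : ℕ} (hi : i < blockLength γ S b) :
    blockStart γ S (γ ^ i * b) = b := by
  rw [blockStart, stepsTo_inv_pow_mul hb hi]
  simp

theorem pow_blockLength (hγ : ∀ g : G, ∃ n : ℕ, γ ^ n = g) {b : G} (hb : S b) :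
    S (γ ^ blockLength γ S b * b) := by
  rw [blockLength, pow_succ, mul_assoc]
  exact stepsTo_spec hγ ⟨b, hb⟩ _

theorem pow_mul_blockStart (g : G) :
    γ ^ stepsTo γ⁻¹ S g * blockStart γ S g = g := by
  simp [blockStart]

variable [Fintype G]

theorem blockStart_spec (hγ : ∀ g : G, ∃ n : ℕ, γ ^ n = g) (hS : ∃ g, S g) (g : G) :
    S (blockStart γ S g) :=
  stepsTo_spec (exists_inv_pow hγ) hS g

theorem stepsTo_lt_blockLength (hγ : ∀ g : G, ∃ n : ℕ, γ ^ n = g) (hS : ∃ g, S g) (g : G) :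
    stepsTo γ⁻¹ S g < blockLength γ S (blockStart γ S g) := by
  by_contra! h
  have h1 := pow_blockLength hγ (blockStart_spec hγ hS g)
  have h0 : 0 < blockLength γ S (blockStart γ S g) := Nat.succ_pos _
  -- Otherwise the start of the next block would be met earlier on the way back from `g`, against
  -- minimality.
  have h2 : γ ^ blockLength γ S (blockStart γ S g) * blockStart γ S g =
      γ⁻¹ ^ (stepsTo γ⁻¹ S g - blockLength γ S (blockStart γ S g)) * g := by
    have := inv_pow_mul_pow (γ := γ) (Nat.sub_le (stepsTo γ⁻¹ S g)
      (blockLength γ S (blockStart γ S g))) (blockStart γ S g)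
    rw [Nat.sub_sub_self h, pow_mul_blockStart] at this
    exact this.symm
  rw [h2] at h1
  have := stepsTo_le h1
  omega

open Classical in
-- Every element is `γ ^ i * b` for exactly one block start `b` and one `i` below the length of its
-- block.
theorem sum_blocks (hγ : ∀ g : G, ∃ n : ℕ, γ ^ n = g) (hS : ∃ g, S g) (y : G → ℤ) :
    ∑ g, y g = ∑ b, if S b then ∑ i ∈ Finset.range (blockLength γ S b), y (γ ^ i * b) else 0 := by
  rw [← Finset.sum_filter, Finset.sum_sigma']
  refine Finset.sum_bij' (fun g _ => ⟨blockStart γ S g, stepsTo γ⁻¹ S g⟩)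
    (fun p _ => γ ^ p.2 * p.1) ?_ ?_ ?_ ?_ ?_
  · intro g _
    simp [blockStart_spec hγ hS, stepsTo_lt_blockLength hγ hS]
  · simp
  · exact fun g _ => pow_mul_blockStart g
  · rintro ⟨b, i⟩ h
    simp only [Finset.mem_sigma, Finset.mem_filter, Finset.mem_univ, true_and,
      Finset.mem_range] at h
    simp only
    rw [blockStart_pow_mul h.1 h.2, stepsTo_inv_pow_mul h.1 h.2]
  · intro g _
    simp only
    rw [pow_mul_blockStart]

end Blocks

theorem sum_min_sub (q F l : ℕ) :
    ∑ i ∈ Finset.range l, min q (F - i * q) = min F (l * q) := by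
  induction l with
  | zero => simp
  | succ l ih =>
    rw [Finset.sum_range_succ, ih, add_mul, one_mul]
    omega

/-- A nonzero letter can only follow a `q`, so the word is `q, …, q, r, 0, …, 0` and its sum
determines it. -/
theorem eq_min_sub_of_sum {q : ℕ} (l : ℕ) : ∀ (y : ℕ → ℕ), (∀ i < l, y i ≤ q) →
    (∀ i, i + 1 < l → y (i + 1) = 0 ∨ y i = q) →
    ∀ i < l, y i = min q (∑ j ∈ Finset.range l, y j - i * q) := by
  induction l with
  | zero => simp
  | succ l ih =>
    intro y hy h i hi
    have ih' := ih (fun i => y (i + 1)) (fun i hi => hy _ (by omega))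
      (fun i hi => h (i + 1) (by omega))
    rw [Finset.sum_range_succ']
    have h0 := hy 0 (by omega)
    rcases i with _ | i
    · rcases eq_or_lt_of_le h0 with e | e
      · omega
      · have hz : ∀ j < l, y (j + 1) = 0 := by
          intro j
          induction j with
          | zero => exact fun hj => (h 0 (by omega)).resolve_right (by omega)
          | succ j ihj =>
            intro hj
            exact (h (j + 1) (by omega)).resolve_right (by rw [ihj (by omega)]; omega)
        rw [Finset.sum_eq_zero fun j hj => hz j (Finset.mem_range.1 hj)]
        omega
    · rcases eq_or_lt_of_le h0 with e | e
      · rw [ih' i (by omega), add_mul, one_mul, e]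
        omega
      · have hz : ∀ j < l, y (j + 1) = 0 := by
          intro j
          induction j with
          | zero => exact fun hj => (h 0 (by omega)).resolve_right (by omega)
          | succ j ihj =>
            intro hj
            exact (h (j + 1) (by omega)).resolve_right (by rw [ihj (by omega)]; omega)
        rw [Finset.sum_eq_zero fun j hj => hz j (Finset.mem_range.1 hj), hz i (by omega),
          add_mul, one_mul]
        omega

theorem ShiftRel.sum_eq {G I P : Type} [Group G] [MulAction G I] [Fintype I] {f f' : I → P}
    (h : ShiftRel G f f') (ρ : P → ℤ) : ∑ i, ρ (f i) = ∑ i, ρ (f' i) := by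
  obtain ⟨g, hg⟩ := h
  simp only [hg]
  exact (Equiv.sum_comp (MulAction.toPerm g) fun i => ρ (f i)).symm

/-- The chain representing `δ` already runs from rank `2 - N` to `N - 2`, so `x₀` and `x₁` extend it
by one step at each end. -/
theorem HasSymmChains.insert_bot_top {X : Type} [Preorder X] {ρ : X → ℤ} {s : X → X → Prop}
    {A : Set X} (hA : HasSymmChains ρ s A) (equiv : Equivalence s)
    (inv : ∀ x y, s x y → ρ x = ρ y) {N : ℕ} (hN : 2 ≤ N) {x₀ x₁ δ : X}
    (h₀ : ρ x₀ = -N) (h₁ : ρ x₁ = N) (hδ : δ ∈ A) (hρδ : ρ δ = 2 - N)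
    (lt : ∀ x ∈ A, -(N : ℤ) < ρ x) (gt : ∀ x ∈ A, ρ x < N)
    (hbot : ∀ x ∈ A, x₀ ≤ x) (htop : ∀ x ∈ A, x ≤ x₁) :
    HasSymmChains ρ s (insert x₀ (insert x₁ A)) := by
  classical
  obtain ⟨ι, m, e, he, hρ, hm, hs, hi⟩ := hA
  obtain ⟨k, j₀, hj₀, hk⟩ := hs δ hδ
  -- The chain meets rank `2 - N`, and its first rank has the same parity and exceeds `-N`; hence it
  -- starts at `2 - N`.
  have hmk : m k + 2 = N := by
    have h1 := inv _ _ hk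
    have h2 := lt _ (he k 0 (Nat.zero_le _))
    rw [hρ _ _ hj₀, hρδ] at h1
    rw [hρ _ _ (Nat.zero_le _)] at h2
    push_cast at h2
    omega
  let c : ℕ → X := fun j => if j = 0 then x₀ else if j = N then x₁ else e k (j - 1)
  let m' : ι → ℕ := Function.update m k N
  let e' : ι → ℕ → X := Function.update e k c
  have hm'k : m' k = N := Function.update_self ..
  have he'k : e' k = c := Function.update_self ..
  have hm' : ∀ i ≠ k, m' i = m i := fun i h => Function.update_of_ne h _ _
  have he' : ∀ i ≠ k, e' i = e i := fun i h => Function.update_of_ne h _ _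
  have c0 : c 0 = x₀ := if_pos rfl
  have cN : c N = x₁ := (if_neg (by omega)).trans (if_pos rfl)
  have cmid : ∀ j, 0 < j → j < N → c j = e k (j - 1) := fun j h h' =>
    (if_neg (by omega)).trans (if_neg (by omega))
  have hc : ∀ j ≤ N, j = 0 ∨ j = N ∨ (0 < j ∧ j < N) := fun j hj => by omega
  have rk : ∀ i j, j ≤ m' i → ρ (e' i j) = 2 * j - m' i := by
    intro i j hj
    by_cases h : i = k
    · subst h
      rw [hm'k] at hj ⊢
      rw [he'k]
      rcases hc j hj with rfl | rfl | ⟨h1, h2⟩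
      · rw [c0, h₀]
        simp
      · rw [cN, h₁]
        ring
      · rw [cmid j h1 h2, hρ _ _ (by omega)]
        omega
    · rw [hm' i h] at hj ⊢
      rw [he' i h, hρ _ _ hj]
  have mem' : ∀ i j, j ≤ m' i → e' i j ∈ A ∨ i = k ∧ (ρ (e' i j) = -N ∨ ρ (e' i j) = N) := by
    intro i j hj
    by_cases h : i = k
    · subst h
      rw [hm'k] at hj
      rw [he'k]
      rcases hc j hj with rfl | rfl | ⟨h1, h2⟩
      · exact Or.inr ⟨rfl, Or.inl (by rw [c0, h₀])⟩
      · exact Or.inr ⟨rfl, Or.inr (by rw [cN, h₁])⟩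
      · rw [cmid j h1 h2]
        exact Or.inl (he _ _ (by omega))
    · rw [hm' i h] at hj
      rw [he' i h]
      exact Or.inl (he _ _ hj)
  have ends : ∀ i j i' j', j ≤ m' i → j' ≤ m' i' → i = k →
      (ρ (e' i j) = -N ∨ ρ (e' i j) = N) → s (e' i j) (e' i' j') → i = i' := by
    intro i j i' j' hj hj' hik hr h
    rw [inv _ _ h] at hr
    rcases mem' i' j' hj' with h1 | h1
    · have := lt _ h1
      have := gt _ h1
      omega
    · rw [hik, h1.1]
  refine ⟨ι, m', e', ?_, rk, ?_, ?_, ?_⟩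
  · intro i j hj
    by_cases h : i = k
    · subst h
      rw [hm'k] at hj
      rw [he'k]
      rcases hc j hj with rfl | rfl | ⟨h1, h2⟩
      · exact Or.inl c0
      · exact Or.inr (Or.inl cN)
      · rw [cmid j h1 h2]
        exact Or.inr (Or.inr (he _ _ (by omega)))
    · rw [hm' i h] at hj
      rw [he' i h]
      exact Or.inr (Or.inr (he _ _ hj))
  · intro i j j' hjj hj'
    by_cases h : i = k
    · subst h
      rw [hm'k] at hj'
      rw [he'k]
      rcases hc j (hjj.trans hj') with rfl | rfl | ⟨h1, h2⟩ <;>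
        rcases hc j' hj' with rfl | rfl | ⟨h3, h4⟩
      · exact le_rfl
      · rw [c0, cN]
        exact (hbot _ hδ).trans (htop _ hδ)
      · rw [c0, cmid _ h3 h4]
        exact hbot _ (he _ _ (by omega))
      · omega
      · exact le_rfl
      · omega
      · omega
      · rw [cN, cmid _ h1 h2]
        exact htop _ (he _ _ (by omega))
      · rw [cmid _ h1 h2, cmid _ h3 h4]
        exact hm _ _ _ (by omega) (by omega)
    · rw [hm' i h] at hj'
      rw [he' i h]
      exact hm _ _ _ hjj hj'
  · rintro x (rfl | rfl | hx)
    · exact ⟨k, 0, Nat.zero_le _, by rw [he'k, c0]; exact equiv.refl _⟩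
    · exact ⟨k, N, hm'k.ge, by rw [he'k, cN]; exact equiv.refl _⟩
    · obtain ⟨i, j, hj, h⟩ := hs x hx
      by_cases hik : i = k
      · subst hik
        refine ⟨i, j + 1, by omega, ?_⟩
        rw [he'k, cmid _ (by omega) (by omega)]
        exact h
      · refine ⟨i, j, by rwa [hm' i hik], ?_⟩
        rw [he' i hik]
        exact h
  · intro i j i' j' hj hj' h
    by_cases h1 : i = k
    · subst h1
      by_cases h2 : i' = i
      · exact h2.symm
      · rcases mem' i j hj with h3 | ⟨-, h3⟩
        · rw [he' i' h2] at h
          rw [hm' i' h2] at hj'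
          rw [hm'k] at hj
          rw [he'k] at h h3
          rcases hc j hj with rfl | rfl | ⟨h4, h5⟩
          · rw [c0] at h3
            have := lt _ h3
            omega
          · rw [cN] at h3
            have := gt _ h3
            omega
          · rw [cmid j h4 h5] at h
            exact hi _ _ _ _ (by omega) hj' h
        · exact ends _ _ _ _ hj hj' rfl h3 h
    · by_cases h2 : i' = k
      · subst h2
        rcases mem' i' j' hj' with h3 | ⟨-, h3⟩
        · rw [he' i h1] at h
          rw [hm' i h1] at hj
          rw [hm'k] at hj'
          rw [he'k] at h h3
          rcases hc j' hj' with rfl | rfl | ⟨h4, h5⟩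
          · rw [c0] at h3
            have := lt _ h3
            omega
          · rw [cN] at h3
            have := gt _ h3
            omega
          · rw [cmid j' h4 h5] at h
            exact hi _ _ _ _ hj (by omega) h
        · exact (ends _ _ _ _ hj' hj rfl h3 (equiv.symm h)).symm
      · rw [he' i h1, he' i' h2] at h
        rw [hm' i h1] at hj
        rw [hm' i' h2] at hj'
        exact hi _ _ _ _ hj hj' h

/-! ### Cyclic words and their block sums -/

section Words

variable {G : Type} [CommGroup G]

/-- The places where a new block of the cyclic word `x` in the letters `0, …, q` starts. -/
def IsBlockStart (γ : G) (q : ℕ) (x : G → ℕ) (g : G) : Prop :=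
  0 < x g ∧ x (γ⁻¹ * g) < q

/-- The word with blocks starting at the elements of `S` and with sum `f b + 1` over the block
starting at `b`, where each block is of the form `q, …, q, r, 0, …, 0`. -/
noncomputable def blockWord (γ : G) (q : ℕ) (S : G → Prop) (f : G → ℕ) (g : G) : ℕ :=
  min q (f (blockStart γ S g) + 1 - stepsTo γ⁻¹ S g * q)

open Classical in
/-- The largest value `f b` may take in `blockWord γ q S f`. -/
noncomputable def blockBound (γ : G) (q : ℕ) (S : G → Prop) (b : G) : ℕ :=
  if S b then blockLength γ S b * q - 2 else 0

theorem blockWord_pow_mul {γ : G} {q : ℕ} {S : G → Prop} {f : G → ℕ} {b : G} (hb : S b) {i : ℕ}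
    (hi : i < blockLength γ S b) :
    blockWord γ q S f (γ ^ i * b) = min q (f b + 1 - i * q) := by
  rw [blockWord, blockStart_pow_mul hb hi, stepsTo_inv_pow_mul hb hi]

theorem blockBound_of_mem {γ : G} {q : ℕ} {S : G → Prop} {b : G} (hb : S b) :
    blockBound γ q S b = blockLength γ S b * q - 2 := if_pos hb

theorem blockBound_of_not_mem {γ : G} {q : ℕ} {S : G → Prop} {b : G} (hb : ¬ S b) :
    blockBound γ q S b = 0 := if_neg hb

theorem sum_blockWord {γ : G} {q : ℕ} {S : G → Prop} {f : G → ℕ} {b : G} (hb : S b)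
    (hlen : 2 ≤ blockLength γ S b * q) (hf : f b ≤ blockBound γ q S b) :
    ∑ i ∈ Finset.range (blockLength γ S b), blockWord γ q S f (γ ^ i * b) = f b + 1 := by
  rw [Finset.sum_congr rfl fun i hi => blockWord_pow_mul hb (Finset.mem_range.1 hi), sum_min_sub]
  rw [blockBound_of_mem hb] at hf
  omega

variable {γ : G} {q : ℕ} {S : G → Prop} {f : G → ℕ}

theorem blockWord_injective (hf : ∀ b, f b ≤ blockBound γ q S b) {f' : G → ℕ}
    (hlen : ∀ b, S b → 2 ≤ blockLength γ S b * q)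
    (hf' : ∀ b, f' b ≤ blockBound γ q S b)
    (h : blockWord γ q S f = blockWord γ q S f') : f = f' := by
  funext b
  by_cases hb : S b
  · have h1 := sum_blockWord hb (hlen b hb) (hf b)
    rw [h, sum_blockWord hb (hlen b hb) (hf' b)] at h1
    omega
  · have h1 := hf b
    have h2 := hf' b
    rw [blockBound_of_not_mem hb] at h1 h2
    omega

variable [Fintype G]

/-- The sum over a block of length `l` lies between `1` and `l * q - 1`: its first letter is
positive, its last is below `q`, and inside it a positive letter only follows a `q`. -/
theorem isBlockStart_blockWord (hγ : ∀ g : G, ∃ n : ℕ, γ ^ n = g) (hq : 0 < q) (hS : ∃ g, S g)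
    (hlen : ∀ b, S b → 2 ≤ blockLength γ S b * q) (hf : ∀ b, f b ≤ blockBound γ q S b) :
    IsBlockStart γ q (blockWord γ q S f) = S := by
  have hdecomp : ∀ g, ∃ b i, S b ∧ i < blockLength γ S b ∧ γ ^ i * b = g := fun g =>
    ⟨_, _, blockStart_spec hγ hS g, stepsTo_lt_blockLength hγ hS g, pow_mul_blockStart g⟩
  funext g
  obtain ⟨b, i, hb, hi, hg⟩ := hdecomp (γ⁻¹ * g)
  have hg' : g = γ ^ (i + 1) * b := by rw [pow_succ', mul_assoc, hg, mul_inv_cancel_left]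
  rw [IsBlockStart, ← hg, blockWord_pow_mul hb hi]
  refine propext ⟨fun ⟨h1, h2⟩ => ?_, fun h => ⟨?_, ?_⟩⟩
  · by_contra h
    have hi' : i + 1 < blockLength γ S b := by
      refine lt_of_le_of_ne hi fun e => h ?_
      rw [hg', e]
      exact pow_blockLength hγ hb
    rw [hg', blockWord_pow_mul hb hi', add_mul, one_mul] at h1
    omega
  · have := blockWord_pow_mul (q := q) (f := f) (γ := γ) h (Nat.succ_pos _ : 0 < _)
    rw [pow_zero, one_mul] at this
    rw [this]
    omega
  · have hi' : i + 1 = blockLength γ S b := by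
      by_contra e
      exact not_of_lt_blockLength (Nat.succ_pos i) (by omega) (hg' ▸ h)
    have h1 := hf b
    have h2 := hlen b hb
    rw [blockBound_of_mem hb, ← hi'] at h1
    rw [← hi'] at h2
    rw [add_mul, one_mul] at h1 h2
    omega

theorem exists_blockWord (hγ : ∀ g : G, ∃ n : ℕ, γ ^ n = g) {x : G → ℕ} (hx : ∀ g, x g ≤ q)
    (hS : ∃ g, IsBlockStart γ q x g) :
    (∀ b, IsBlockStart γ q x b → 2 ≤ blockLength γ (IsBlockStart γ q x) b * q) ∧
    ∃ f : G → ℕ, (∀ b, f b ≤ blockBound γ q (IsBlockStart γ q x) b) ∧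
      blockWord γ q (IsBlockStart γ q x) f = x := by
  classical
  set S := IsBlockStart γ q x with hSdef
  let F : G → ℕ := fun b => ∑ i ∈ Finset.range (blockLength γ S b), x (γ ^ i * b)
  have hword : ∀ b, S b → ∀ i < blockLength γ S b, x (γ ^ i * b) = min q (F b - i * q) := by
    intro b hb
    refine eq_min_sub_of_sum _ (fun i => x (γ ^ i * b)) (fun _ _ => hx _) fun i hi => ?_
    have := not_of_lt_blockLength (Nat.succ_pos i) hi
    rw [hSdef, IsBlockStart, not_and_or, pow_succ', mul_assoc, inv_mul_cancel_left] at this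
    have := hx (γ ^ i * b)
    rw [pow_succ', mul_assoc]
    omega
  have hF : ∀ b, S b → 0 < F b ∧ F b + 1 ≤ blockLength γ S b * q := by
    intro b hb
    have h0 := hword b hb 0 (Nat.succ_pos _)
    rw [pow_zero, one_mul] at h0
    have h1 := hb.1
    refine ⟨by omega, ?_⟩
    have h2 := hword b hb (stepsTo γ S (γ * b)) (Nat.lt_succ_self _)
    have h3 := (pow_blockLength hγ hb).2
    rw [blockLength, pow_succ', mul_assoc, inv_mul_cancel_left, h2] at h3
    rw [blockLength, add_mul, one_mul]
    omega
  refine ⟨fun b hb => by have := hF b hb; omega,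
    fun b => if S b then F b - 1 else 0, fun b => ?_, funext fun g => ?_⟩
  · dsimp only
    split_ifs with hb
    · rw [blockBound_of_mem hb]
      have := hF b hb
      omega
    · exact Nat.zero_le _
  · have hb := blockStart_spec hγ hS g
    have h1 := hword _ hb _ (stepsTo_lt_blockLength hγ hS g)
    rw [pow_mul_blockStart] at h1
    rw [blockWord, if_pos hb, h1, Nat.sub_add_cancel (hF _ hb).1]

theorem sum_blockWord_rank (hγ : ∀ g : G, ∃ n : ℕ, γ ^ n = g) (hS : ∃ g, S g)
    (hlen : ∀ b, S b → 2 ≤ blockLength γ S b * q) (hf : ∀ b, f b ≤ blockBound γ q S b) :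
    ∑ g, (2 * (blockWord γ q S f g : ℤ) - q) = ∑ b, (2 * (f b : ℤ) - blockBound γ q S b) := by
  classical
  rw [sum_blocks hγ hS]
  refine Finset.sum_congr rfl fun b _ => ?_
  split_ifs with hb
  -- With `l` the block length, `2 * (f b + 1) - l * q = 2 * f b - (l * q - 2)`: the shift by `1`
  -- and the bound lowered by `2` cancel.
  · rw [Finset.sum_sub_distrib, ← Finset.mul_sum, ← Nat.cast_sum,
      sum_blockWord hb (hlen b hb) (hf b), blockBound_of_mem hb, Nat.cast_sub (hlen b hb)]
    simp
    ring
  · have h := hf b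
    rw [blockBound_of_not_mem hb] at h ⊢
    simp [Nat.le_zero.1 h]

/-- Without block starts, a letter below `q` is followed by `0`, and this propagates around the
whole cycle. -/
theorem eq_const_of_forall_not_isBlockStart (hγ : ∀ g : G, ∃ n : ℕ, γ ^ n = g)
    {x : G → ℕ} (hx : ∀ g, x g ≤ q) (h : ∀ g, ¬ IsBlockStart γ q x g) :
    (∀ g, x g = 0) ∨ ∀ g, x g = q := by
  by_contra! hc
  obtain ⟨⟨g, hg⟩, g₀, h₀⟩ := hc
  have hlt : x g₀ < q := lt_of_le_of_ne (hx _) h₀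
  have step : ∀ g, x g < q → x (γ * g) = 0 := fun g hg => by
    have := h (γ * g)
    rw [IsBlockStart, inv_mul_cancel_left] at this
    omega
  have hall : ∀ n : ℕ, x (γ ^ n * (γ * g₀)) = 0 := by
    intro n
    induction n with
    | zero => simpa using step g₀ hlt
    | succ n ih =>
      rw [pow_succ', mul_assoc]
      exact step _ (by omega)
  obtain ⟨n, hn⟩ := hγ (g * (γ * g₀)⁻¹)
  have := hall n
  rw [hn, inv_mul_cancel_right] at this
  exact hg this

end Words

/-! ### Boxes modulo a subgroup of a cyclic group -/

theorem BoxHasSymmChains.of_top {G : Type} [Group G] [Fintype G] {H : Subgroup G} (hH : H = ⊤)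
    {m : G → ℕ} (h : BoxHasSymmChains G m) : BoxHasSymmChains H m := by
  subst hH
  refine HasSymmChains.congr_rel h fun f f' => ⟨?_, ?_⟩
  · rintro ⟨g, hg⟩
    exact ⟨⟨g, trivial⟩, hg⟩
  · rintro ⟨⟨g, _⟩, hg⟩
    exact ⟨g, hg⟩

theorem BoxHasSymmChains.of_subsingleton {G : Type} [Group G] [Fintype G] [Subsingleton G]
    (m : G → ℕ) : BoxHasSymmChains G m := by
  refine (HasSymmChains.box_eq m).congr_rel fun f f' => ⟨?_, ?_⟩
  · rintro rfl
    exact (ShiftRel.equivalence G).refl _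
  · rintro ⟨g, hg⟩
    funext x
    rw [hg, Subsingleton.elim (g • x) x]

/-- Induction on `q`, with the set of block starts as label. The hypothesis `box` handles every
label whose period is proper. -/
theorem boxHasSymmChains_const {G : Type} [CommGroup G] [Fintype G] {γ : G}
    (hγ : ∀ g : G, ∃ n : ℕ, γ ^ n = g)
    (box : ∀ (H : Subgroup G), H ≠ ⊤ → ∀ m : G → ℕ, (∀ h ∈ H, ∀ x, m (h * x) = m x) →
      BoxHasSymmChains H m) (q : ℕ) :
    BoxHasSymmChains G (fun _ : G => q) := by
  classical
  induction q using Nat.strong_induction_on with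
  | _ q ih =>
  rcases subsingleton_or_nontrivial G with hG | hG
  · exact .of_subsingleton _
  rcases Nat.eq_zero_or_pos q with rfl | hq
  · refine ⟨Unit, fun _ => 0, fun _ _ => 0, ?_, ?_, ?_, ?_, ?_⟩
    · simp
    · simp
    · simp
    · intro x hx
      exact ⟨(), 0, le_rfl, 1, fun g => (Nat.le_zero.1 (hx _)).symm⟩
    · simp
  have hmain : HasSymmChains (fun f : G → ℕ => ∑ i, (2 * (f i : ℤ) - q)) (ShiftRel G)
      {f | (∀ g, f g ≤ q) ∧ ∃ g, IsBlockStart γ q f g} := by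
    refine HasSymmChains.shift_glue (Λ := Prop)
      {S | (∃ g, S g) ∧ ∀ b, S b → 2 ≤ blockLength γ S b * q}
      (blockBound γ q) (blockWord γ q) ?_ ?_ ?_ ?_ ?_ ?_ ?_ ?_ ?_
    · rintro S ⟨⟨g, hg⟩, hS⟩ h
      refine ⟨⟨h⁻¹ * g, by simpa using hg⟩, fun b hb => ?_⟩
      rw [blockLength_shift]
      exact hS _ hb
    · intro S _ h x
      simp only [blockBound, blockLength_shift]
    · intro S _ h f _
      funext x
      simp only [blockWord, stepsTo_shift, blockStart_shift]
    · rintro S ⟨⟨g, hg⟩, hS⟩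
      -- A nonempty `S` with full period is all of `G`; blocks have length `1` and the bound drops
      -- to the constant `q - 2`.
      by_cases hp : periodSubgroup S = ⊤
      · have hall : ∀ b, S b := fun b => by
          have : b * g⁻¹ ∈ periodSubgroup S := hp ▸ Subgroup.mem_top _
          have := this g
          rw [inv_mul_cancel_right] at this
          rwa [this]
        have hlen : ∀ b, blockLength γ S b = 1 := fun b =>
          congrArg Nat.succ (Nat.le_zero.1 (stepsTo_le (hall _)))
        have hb : blockBound γ q S = fun _ => q - 2 := funext fun b => by
          rw [blockBound_of_mem (hall b), hlen, one_mul]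
        rw [hb]
        exact .of_top hp (ih _ (by omega))
      · refine box _ hp _ fun h hh x => ?_
        have hS' : (fun x => S (h * x)) = S := funext hh
        simp only [blockBound, ← blockLength_shift, hS', hh x]
    · rintro S ⟨hS, hlen⟩ f hf
      refine ⟨fun g => min_le_left _ _, ?_⟩
      rwa [isBlockStart_blockWord hγ hq hS hlen hf]
    · rintro S ⟨hS, hlen⟩ f hf
      exact sum_blockWord_rank hγ hS hlen hf
    · intro S _ f _ f' _ h g
      have := h (blockStart γ S g)
      exact min_le_min_left q (Nat.sub_le_sub_right (Nat.succ_le_succ this) _)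
    · rintro x ⟨hx, hS⟩
      obtain ⟨h1, f, hf, h2⟩ := exists_blockWord hγ hx hS
      exact ⟨_, ⟨hS, h1⟩, f, hf, h2⟩
    · rintro S ⟨hS, hlen⟩ f hf S' ⟨hS', hlen'⟩ f' hf' h
      have h1 : S = S' := by
        rw [← isBlockStart_blockWord hγ hq hS hlen hf, h,
          isBlockStart_blockWord hγ hq hS' hlen' hf']
      subst h1
      exact ⟨rfl, blockWord_injective hf hlen hf' h⟩
  have hγ1 : γ⁻¹ ≠ 1 := fun h => by
    obtain ⟨g, hg⟩ := exists_ne (1 : G)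
    obtain ⟨n, hn⟩ := hγ g
    rw [inv_eq_one.1 h, one_pow] at hn
    exact hg hn.symm
  have hN : 2 ≤ Fintype.card G * q :=
    (Fintype.one_lt_card (α := G)).trans_le (Nat.le_mul_of_pos_right _ hq)
  have hrank : ∀ f : G → ℕ, ∑ i, (2 * (f i : ℤ) - q) =
      2 * ((∑ i, f i : ℕ) : ℤ) - (Fintype.card G * q : ℕ) := fun f => by
    rw [Finset.sum_sub_distrib, ← Finset.mul_sum]
    simp
  -- The word with a single letter `1` has rank `2 - |G| * q` and a block start at `1`, as `γ⁻¹ ≠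
  -- 1`.
  have hfull := hmain.insert_bot_top (x₀ := fun _ => 0) (x₁ := fun _ => q) (δ := Pi.single 1 1)
    (ShiftRel.equivalence G) (fun _ _ h => h.sum_eq fun n : ℕ => 2 * (n : ℤ) - q) hN
    (by rw [hrank]; simp) (by rw [hrank]; simp; ring)
    ⟨fun g => (by by_cases h : g = 1 <;> simp [h] ; omega), 1, by simp, by
      simpa [hγ1] using hq⟩ (by rw [hrank]; simp) ?_ ?_ (fun x _ g => Nat.zero_le _)
    (fun x hx => hx.1)
  · have hset : {f : G → ℕ | ∀ g, f g ≤ q} = insert (fun _ => 0) (insert (fun _ => q)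
        {f | (∀ g, f g ≤ q) ∧ ∃ g, IsBlockStart γ q f g}) := by
      ext f
      refine ⟨fun hf => ?_, ?_⟩
      · by_cases h : ∃ g, IsBlockStart γ q f g
        · exact Or.inr (Or.inr ⟨hf, h⟩)
        · rcases eq_const_of_forall_not_isBlockStart hγ hf (not_exists.1 h) with h | h
          · exact Or.inl (funext h)
          · exact Or.inr (Or.inl (funext h))
      · rintro (rfl | rfl | h)
        · exact fun _ => Nat.zero_le _
        · exact fun _ => le_rfl
        · exact h.1
    rw [BoxHasSymmChains, hset]
    exact hfull
  · rintro x ⟨-, g, hg, -⟩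
    rw [hrank]
    have := Finset.single_le_sum (fun i _ => Nat.zero_le (x i)) (Finset.mem_univ g)
    omega
  · rintro x ⟨hx, g, -, hg⟩
    rw [hrank]
    have : ∑ i, x i < ∑ _i : G, q :=
      Finset.sum_lt_sum (fun i _ => hx i) ⟨_, Finset.mem_univ _, hg⟩
    simp only [Finset.sum_const, Finset.card_univ, smul_eq_mul] at this
    omega

/-- Induction on `|G|`: a proper `H` acts freely on `G` by translation and leads to boxes on `H`
itself, while for `H = ⊤` invariance makes `m` constant. -/
theorem boxHasSymmChains {G : Type} [CommGroup G] [Fintype G] [IsCyclic G] (H : Subgroup G)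
    (m : G → ℕ) (hm : ∀ h ∈ H, ∀ x, m (h * x) = m x) : BoxHasSymmChains H m := by
  classical
  induction hn : Fintype.card G using Nat.strong_induction_on generalizing G with
  | _ n ih =>
  subst hn
  have proper : ∀ (H : Subgroup G), H ≠ ⊤ → ∀ m : G → ℕ, (∀ h ∈ H, ∀ x, m (h * x) = m x) →
      BoxHasSymmChains H m := by
    intro H hH m hm
    have hcard : Fintype.card H < Fintype.card G := by
      refine Fintype.card_lt_of_injective_not_surjective (↑) Subtype.val_injective fun h => hH ?_
      exact (Subgroup.eq_top_iff' H).2 fun g => by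
        obtain ⟨k, rfl⟩ := h g
        exact k.2
    refine HasSymmChains.free_of_power (G := H) (ρ := fun i (x : ℕ) => 2 * (x : ℤ) - m i)
      (A := fun i => Set.Iic (m i)) (fun hA => HasSymmChains.power_of_box
        (fun K m hm => ih _ hcard K m hm rfl) hA) ?_ ?_ ?_ fun i => HasSymmChains.Iic (m i)
    · intro g i h
      rw [Subgroup.smul_def, smul_eq_mul, mul_eq_right] at h
      exact Subtype.ext h
    · intro g i
      rw [Subgroup.smul_def, smul_eq_mul, hm _ g.2]
    · intro g i
      rw [Subgroup.smul_def, smul_eq_mul, hm _ g.2]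
  by_cases hH : H = ⊤
  · have hconst : m = fun _ => m 1 := funext fun x => by
      have := hm x (hH ▸ Subgroup.mem_top _) 1
      rwa [mul_one] at this
    obtain ⟨γ, hγ⟩ := IsCyclic.exists_generator (α := G)
    rw [hconst]
    exact .of_top hH (boxHasSymmChains_const
      (fun g => (Submonoid.mem_powers_iff _ _).1 (mem_powers_iff_mem_zpowers.2 (hγ g))) proper _)
  · exact proper H hH m hm

/-- If `P` has a symmetric chain decomposition and a finite cyclic group acts freely on `I`, then
the functions from `I` to `P` modulo the group have a symmetric chain decomposition. -/
theorem HasSymmChains.fun_of_free {G I P : Type} [CommGroup G] [Finite G] [IsCyclic G]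
    [Fintype I] [MulAction G I] [Preorder P] {ρ : P → ℤ} {A : Set P}
    (free : ∀ (g : G) (i : I), g • i = i → g = 1) (hA : HasSymmChains ρ Eq A) :
    HasSymmChains (fun f : I → P => ∑ i, ρ (f i)) (ShiftRel G) {f | ∀ i, f i ∈ A} := by
  have := Fintype.ofFinite G
  exact free_of_power (G := G) (ρ := fun _ => ρ) (A := fun _ => A)
    (fun h => power_of_box boxHasSymmChains h) free (fun _ _ => rfl) (fun _ _ => rfl)
    fun _ => hA

/-! ### Groups generated by powers of disjoint cycles -/

section LabelledFibers

variable {I κ : Type} {lab : I → κ} {γ : κ → Equiv.Perm I}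

theorem label_apply_of_mem_closure (pres : ∀ k i, lab (γ k i) = lab i) {τ : Equiv.Perm I}
    (hτ : τ ∈ Subgroup.closure (Set.range γ)) (i : I) : lab (τ i) = lab i := by
  induction hτ using Subgroup.closure_induction generalizing i with
  | mem τ h =>
    obtain ⟨k, rfl⟩ := h
    exact pres k i
  | one => rfl
  | mul τ τ' _ _ h h' => rw [Equiv.Perm.mul_apply, h, h']
  | inv τ _ h => rw [← h (τ⁻¹ i)]; simp

theorem label_zpow_apply (pres : ∀ k i, lab (γ k i) = lab i) (k : κ) (n : ℤ) (i : I) :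
    lab ((γ k ^ n) i) = lab i :=
  label_apply_of_mem_closure pres
    (Subgroup.zpow_mem _ (Subgroup.subset_closure (Set.mem_range_self k)) n) i

theorem exists_zpow_of_mem_closure (pres : ∀ k i, lab (γ k i) = lab i)
    (fix : ∀ k i, lab i ≠ k → γ k i = i) {τ : Equiv.Perm I}
    (hτ : τ ∈ Subgroup.closure (Set.range γ)) (k : κ) :
    ∃ n : ℤ, ∀ i, lab i = k → τ i = (γ k ^ n) i := by
  induction hτ using Subgroup.closure_induction with
  | mem τ h =>
    obtain ⟨k', rfl⟩ := h
    by_cases hk : k = k'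
    · exact ⟨1, fun i _ => by rw [hk, zpow_one]⟩
    · exact ⟨0, fun i hi => by rw [fix k' i (by rwa [hi]), zpow_zero, Equiv.Perm.one_apply]⟩
  | one => exact ⟨0, fun _ _ => rfl⟩
  | mul τ τ' _ _ h h' =>
    obtain ⟨n, hn⟩ := h
    obtain ⟨n', hn'⟩ := h'
    refine ⟨n + n', fun i hi => ?_⟩
    rw [Equiv.Perm.mul_apply, hn' i hi, hn _ (by rw [label_zpow_apply pres, hi]), zpow_add,
      Equiv.Perm.mul_apply]
  | inv τ _ h =>
    obtain ⟨n, hn⟩ := h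
    refine ⟨-n, fun i hi => ?_⟩
    rw [Equiv.Perm.inv_eq_iff_eq, hn _ (by rw [label_zpow_apply pres, hi]),
      ← Equiv.Perm.mul_apply, ← zpow_add, add_neg_cancel, zpow_zero, Equiv.Perm.one_apply]

theorem exists_mem_closure_of_zpow [Fintype κ] (pres : ∀ k i, lab (γ k i) = lab i)
    (fix : ∀ k i, lab i ≠ k → γ k i = i) (a : κ → ℤ) :
    ∃ τ ∈ Subgroup.closure (Set.range γ), ∀ i, τ i = (γ (lab i) ^ a (lab i)) i := by
  classical
  have fix' : ∀ k (n : ℤ) i, lab i ≠ k → (γ k ^ n) i = i := fun k n i h =>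
    Equiv.Perm.zpow_apply_eq_self_of_apply_eq_self (fix k i h) n
  suffices ∀ s : Finset κ, ∃ τ ∈ Subgroup.closure (Set.range γ), ∀ i,
      τ i = if lab i ∈ s then (γ (lab i) ^ a (lab i)) i else i by
    simpa using this Finset.univ
  intro s
  induction s using Finset.induction_on with
  | empty => exact ⟨1, Subgroup.one_mem _, by simp⟩
  | insert k s hk ih =>
    obtain ⟨τ, hτ, h⟩ := ih
    refine ⟨τ * γ k ^ a k, Subgroup.mul_mem _ hτ
      (Subgroup.zpow_mem _ (Subgroup.subset_closure (Set.mem_range_self k)) _), fun i => ?_⟩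
    rw [Equiv.Perm.mul_apply, h, label_zpow_apply pres]
    by_cases hi : lab i = k
    · rw [if_neg (by rwa [hi]), if_pos (by simp [hi]), hi]
    · rw [fix' k _ i hi]
      simp [hi]

/-- The group acts on the label classes independently, through the cyclic group of `γ k` on class
`k`. That action is free, so the cyclic case on each class combines through `pi`. -/
theorem HasSymmChains.fun_of_labels [Fintype I] [Fintype κ] {P : Type} [Preorder P] {ρ : P → ℤ}
    {A : Set P}
    (pres : ∀ k i, lab (γ k i) = lab i) (fix : ∀ k i, lab i ≠ k → γ k i = i)
    (free : ∀ k (n : ℤ) i, lab i = k → (γ k ^ n) i = i → γ k ^ n = 1)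
    (hA : HasSymmChains ρ Eq A) :
    HasSymmChains (fun f : I → P => ∑ i, ρ (f i)) (ShiftRel (Subgroup.closure (Set.range γ)))
      {f | ∀ i, f i ∈ A} := by
  classical
  let σ : ∀ k, Equiv.Perm {i // lab i = k} := fun k =>
    (γ k).subtypePerm fun i => by rw [pres]
  have hσ : ∀ k (n : ℤ) v, ((σ k ^ n) v : I) = (γ k ^ n) v := fun k n v => by
    simp only [σ]
    rw [Equiv.Perm.subtypePerm_zpow]
    rfl
  have hfib : ∀ k, HasSymmChains (fun f : {i // lab i = k} → P => ∑ i, ρ (f i))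
      (ShiftRel (Subgroup.zpowers (σ k))) {f | ∀ i, f i ∈ A} := by
    intro k
    let _ : CommGroup (Subgroup.zpowers (σ k)) := IsCyclic.commGroup
    refine HasSymmChains.fun_of_free (G := Subgroup.zpowers (σ k)) ?_ hA
    rintro ⟨_, n, rfl⟩ v hv
    refine Subtype.ext (Equiv.ext fun w => Subtype.ext ?_)
    have h := free k n v v.2 ((hσ k n v).symm.trans (congrArg Subtype.val hv))
    simp only [hσ, h]
    rfl
  refine (HasSymmChains.pi hfib (fun k =>
      ShiftRel.equivalence (I := {i // lab i = k}) (P := P) (Subgroup.zpowers (σ k)))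
    (fun k f f' h => h.sum_eq ρ)).map (fun F i => F (lab i) ⟨i, rfl⟩)
    (fun _ _ _ => (ShiftRel.equivalence (Subgroup.closure (Set.range γ))).trans) ?_ ?_ ?_ ?_ ?_ ?_
  · exact fun F hF i => hF _ _
  · intro F _
    rw [← Fintype.sum_sigma']
    refine Fintype.sum_equiv (Equiv.sigmaFiberEquiv lab).symm _ _ fun i => rfl
  · exact fun F _ F' _ h i => h _ _
  · intro F _ F' _ h
    choose g hg using h
    choose a ha using fun k => (g k).2
    obtain ⟨τ, hτ, h⟩ := exists_mem_closure_of_zpow pres fix a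
    refine ⟨⟨τ, hτ⟩, fun i => ?_⟩
    have hF : ∀ (v : I) k (hv : lab v = k), F (lab v) ⟨v, rfl⟩ = F k ⟨v, hv⟩ := by
      rintro v _ rfl
      rfl
    have hl : lab (τ i) = lab i := label_apply_of_mem_closure pres hτ i
    dsimp only
    rw [hg]
    refine Eq.trans ?_ (hF (τ i) (lab i) hl).symm
    refine congrArg (F (lab i)) (Subtype.ext ?_)
    refine Eq.trans ?_ (h i).symm
    have := ha (lab i)
    dsimp only at this
    rw [Subgroup.smul_def, ← this]
    exact hσ _ _ _
  · intro y hy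
    exact ⟨fun k v => y v, fun k v => hy v, (ShiftRel.equivalence (Subgroup.closure (Set.range γ))).refl _⟩
  · rintro F - F' - ⟨⟨τ, hτ⟩, h⟩ k
    obtain ⟨n, hn⟩ := exists_zpow_of_mem_closure pres fix hτ k
    refine ⟨⟨σ k ^ n, n, rfl⟩, ?_⟩
    rintro ⟨i, rfl⟩
    have hF : ∀ (v : I) k (hv : lab v = k), F (lab v) ⟨v, rfl⟩ = F k ⟨v, hv⟩ := by
      rintro v _ rfl
      rfl
    have hl : lab (τ i) = lab i := label_apply_of_mem_closure pres hτ i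
    refine (h i).trans ((hF (τ i) (lab i) hl).trans (congrArg (F (lab i)) (Subtype.ext ?_)))
    refine (hn i rfl).trans ?_
    exact (hσ _ _ ⟨i, rfl⟩).symm

end LabelledFibers

theorem HasSymmChains.fun_of_generatedByPowersOfDisjointCycles {I P : Type} [Fintype I]
    [Preorder P] {ρ : P → ℤ} {A : Set P} {T : Subgroup (Equiv.Perm I)}
    (hT : GeneratedByPowersOfDisjointCycles T) (hA : HasSymmChains ρ Eq A) :
    HasSymmChains (fun f : I → P => ∑ i, ρ (f i)) (ShiftRel T) {f | ∀ i, f i ∈ A} := by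
  classical
  obtain ⟨m, σ, e, hcyc, hdisj, rfl⟩ := hT
  -- A point is labelled by the unique cycle moving it; points moved by none form the class `none`,
  -- with trivial generator.
  have hlab : ∀ i, ∃ o : Option (Fin m), ∀ j, o = some j ↔ σ j i ≠ i := by
    intro i
    by_cases h : ∃ j, σ j i ≠ i
    · obtain ⟨j, hj⟩ := h
      refine ⟨some j, fun j' => ?_⟩
      rw [Option.some_inj]
      refine ⟨fun h => h ▸ hj, fun h => by_contra fun hne => ?_⟩
      rcases hdisj j j' hne i with h1 | h1
      exacts [hj h1, h h1]
    · push Not at h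
      exact ⟨none, fun j => by simp [h]⟩
  choose lab hlab using hlab
  let γ : Option (Fin m) → Equiv.Perm I := fun o => o.elim 1 fun j => σ j ^ e j
  have hcl : Subgroup.closure (Set.range fun i => σ i ^ e i) =
      Subgroup.closure (Set.range γ) := by
    refine le_antisymm (Subgroup.closure_mono ?_) ((Subgroup.closure_le _).2 ?_)
    · rintro _ ⟨j, rfl⟩
      exact ⟨some j, rfl⟩
    · rintro _ ⟨_ | j, rfl⟩
      · exact Subgroup.one_mem _
      · exact Subgroup.subset_closure ⟨j, rfl⟩
  have fix : ∀ o i, lab i ≠ o → γ o i = i := by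
    rintro (_ | j) i h
    · rfl
    · have h1 : σ j i = i := by
        by_contra h1
        exact h ((hlab i j).2 h1)
      exact Equiv.Perm.pow_apply_eq_self_of_apply_eq_self h1 _
  have pres : ∀ o i, lab (γ o i) = lab i := by
    intro o i
    by_cases h : lab i = o
    · rcases o with _ | j
      · rfl
      · rw [h, hlab]
        intro h1
        refine (hlab i j).1 h ((σ j ^ e j).injective ?_)
        change (σ j ^ e j) (σ j i) = (σ j ^ e j) i
        rw [← Equiv.Perm.mul_apply, ← pow_succ, pow_succ', Equiv.Perm.mul_apply]
        exact h1
    · rw [fix o i h]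
  have free : ∀ o (n : ℤ) i, lab i = o → (γ o ^ n) i = i → γ o ^ n = 1 := by
    rintro (_ | j) n i h hn
    · exact one_zpow n
    · have h1 := (hlab i j).1 h
      change ((σ j ^ e j) ^ n) i = i at hn
      change (σ j ^ e j) ^ n = 1
      rw [← zpow_natCast, ← zpow_mul] at hn ⊢
      refine Equiv.ext fun y => ?_
      by_cases hy : σ j y = y
      · exact Equiv.Perm.zpow_apply_eq_self_of_apply_eq_self hy _
      -- A cycle is transitive on its support and commutes with its powers, so a power fixing one
      -- moved point fixes all of them.
      · obtain ⟨k, rfl⟩ := (hcyc j).sameCycle h1 hy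
        rw [← Equiv.Perm.mul_apply, ← zpow_add, add_comm, zpow_add, Equiv.Perm.mul_apply, hn]
        rfl
  rw [hcl]
  exact fun_of_labels pres fix free hA

/-! ### Rank and maximal chains in a quotient of a Boolean lattice -/

section BooleanQuotient

variable {α : Type} {Γ : Subgroup (Equiv.Perm α)}

theorem OrbitPoset.mk_booleanAut_eq_iff {x y : Finset α} :
    OrbitPoset.mk (Γ.map (booleanAut α)) x = OrbitPoset.mk (Γ.map (booleanAut α)) y ↔
      ∃ φ ∈ Γ, x.map φ.toEmbedding = y := by
  rw [eq_comm, OrbitPoset.mk_eq_mk_iff]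
  constructor
  · rintro ⟨_, ⟨φ, hφ, rfl⟩, h⟩
    exact ⟨φ, hφ, h⟩
  · rintro ⟨φ, hφ, h⟩
    exact ⟨_, ⟨φ, hφ, rfl⟩, h⟩

/-- The number of elements of the sets in an orbit. -/
def orbitCard (Γ : Subgroup (Equiv.Perm α)) (a : OrbitPoset (Γ.map (booleanAut α))) : ℕ :=
  Quotient.lift Finset.card (fun x y h => by
    obtain ⟨φ, -, rfl⟩ := OrbitPoset.mk_booleanAut_eq_iff.1
      (Quotient.sound h : OrbitPoset.mk (Γ.map (booleanAut α)) x = OrbitPoset.mk _ y)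
    rw [Finset.card_map]) a

theorem orbitCard_mk (x : Finset α) :
    orbitCard Γ (OrbitPoset.mk (Γ.map (booleanAut α)) x) = x.card := rfl

variable [Fintype α]

theorem OrbitPoset.mk_mono {x y : Finset α} (h : x ≤ y) :
    OrbitPoset.mk (Γ.map (booleanAut α)) x ≤ OrbitPoset.mk (Γ.map (booleanAut α)) y :=
  ⟨x, y, rfl, rfl, h⟩

theorem OrbitPoset.mk_lt_mk {x y : Finset α} (h : x ≤ y) (hc : x.card < y.card) :
    OrbitPoset.mk (Γ.map (booleanAut α)) x < OrbitPoset.mk (Γ.map (booleanAut α)) y :=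
  lt_of_le_of_ne (mk_mono h) fun e => hc.ne (congrArg (orbitCard Γ) e)

theorem orbitCard_strictMono : StrictMono (orbitCard Γ) := by
  intro a b hab
  obtain ⟨x, y, rfl, rfl, h⟩ := hab.le
  refine lt_of_le_of_ne (Finset.card_le_card h) fun e => hab.ne ?_
  rw [Finset.eq_of_subset_of_card_le h e.ge]

theorem exists_orbitCard_eq_of_lt {a b : OrbitPoset (Γ.map (booleanAut α))} (hab : a < b) {r : ℕ}
    (ha : orbitCard Γ a < r) (hb : r < orbitCard Γ b) :
    ∃ c, a < c ∧ c < b ∧ orbitCard Γ c = r := by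
  obtain ⟨x, y, rfl, rfl, h⟩ := hab.le
  obtain ⟨z, hxz, hzy, rfl⟩ := Finset.exists_subsuperset_card_eq h ha.le hb.le
  exact ⟨OrbitPoset.mk _ z, OrbitPoset.mk_lt_mk hxz ha, OrbitPoset.mk_lt_mk hzy hb, rfl⟩

theorem posetRankAt_eq_orbitCard (a : OrbitPoset (Γ.map (booleanAut α))) :
    posetRankAt a = orbitCard Γ a := by
  rw [posetRankAt, Order.height_eq_of_strictMono _ orbitCard_strictMono, Order.height_nat]
  intro a r hr
  obtain ⟨x, rfl⟩ := Quotient.exists_rep a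
  obtain ⟨z, hz, rfl⟩ := Finset.exists_subset_card_eq (le_of_lt hr : r ≤ x.card)
  exact ⟨OrbitPoset.mk _ z, OrbitPoset.mk_lt_mk hz hr, rfl⟩

theorem orbitCard_le (a : OrbitPoset (Γ.map (booleanAut α))) :
    orbitCard Γ a ≤ Fintype.card α := by
  obtain ⟨x, rfl⟩ := Quotient.exists_rep a
  exact Finset.card_le_univ x

theorem posetRank_eq_card :
    posetRank (OrbitPoset (Γ.map (booleanAut α))) = Fintype.card α := by
  refine le_antisymm (iSup_le fun a => ?_)
    (le_iSup_of_le (OrbitPoset.mk _ (Finset.univ : Finset α)) ?_)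
  · rw [posetRankAt_eq_orbitCard]
    exact_mod_cast orbitCard_le a
  · rw [posetRankAt_eq_orbitCard, orbitCard_mk, Finset.card_univ]

/-- A maximal chain contains exactly one orbit of each cardinality: a missing one could be inserted
between its neighbours in the chain. -/
theorem OrbitPoset.ncard_of_isMaxChain {C : Set (OrbitPoset (Γ.map (booleanAut α)))}
    (hC : IsMaxChain (· ≤ ·) C) : C.ncard = Fintype.card α + 1 := by
  have hfin : Finite (OrbitPoset (Γ.map (booleanAut α))) := Quotient.finite _
  let _ : BoundedOrder (OrbitPoset (Γ.map (booleanAut α))) :=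
    { bot := OrbitPoset.mk _ ∅
      top := OrbitPoset.mk _ Finset.univ
      bot_le := by
        rintro ⟨x⟩
        exact OrbitPoset.mk_mono (Finset.empty_subset x)
      le_top := by
        rintro ⟨x⟩
        exact OrbitPoset.mk_mono (Finset.subset_univ x) }
  have hmono := orbitCard_strictMono (Γ := Γ)
  have hlt : ∀ a ∈ C, ∀ b ∈ C, orbitCard Γ a < orbitCard Γ b → a < b := by
    intro a ha b hb h
    rcases hC.1.total ha hb with h1 | h1
    · exact lt_of_le_of_ne h1 fun e => h.ne (congrArg _ e)
    · exact absurd (hmono.monotone h1) (by omega)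
  have hinj : Set.InjOn (orbitCard Γ) C := by
    intro a ha b hb h
    rcases hC.1.total ha hb with h1 | h1
    · exact h1.eq_of_not_lt fun h2 => (hmono h2).ne h
    · exact (h1.eq_of_not_lt fun h2 => (hmono h2).ne h.symm).symm
  have himg : orbitCard Γ '' C = Set.Iic (Fintype.card α) := by
    refine Set.Subset.antisymm ?_ fun r hr => ?_
    · rintro _ ⟨a, -, rfl⟩
      exact orbitCard_le a
    by_contra hr'
    have hne : ∀ c ∈ C, orbitCard Γ c ≠ r := fun c hc h => hr' ⟨c, hc, h⟩
    have hb0 : orbitCard Γ ⊥ = 0 := Finset.card_empty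
    have ht1 : orbitCard Γ ⊤ = Fintype.card α := Finset.card_univ
    have hbot := hne ⊥ hC.bot_mem
    have htop := hne ⊤ hC.top_mem
    obtain ⟨a, ⟨haC, har⟩, ha⟩ := Set.exists_max_image {c ∈ C | orbitCard Γ c < r} (orbitCard Γ)
      (Set.toFinite _) ⟨⊥, hC.bot_mem, by omega⟩
    obtain ⟨b, ⟨hbC, hbr⟩, hb⟩ := Set.exists_min_image {c ∈ C | r < orbitCard Γ c} (orbitCard Γ)
      (Set.toFinite _) ⟨⊤, hC.top_mem, lt_of_le_of_ne (ht1.symm ▸ hr) htop.symm⟩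
    obtain ⟨z, haz, hzb, hz⟩ := exists_orbitCard_eq_of_lt (hlt a haC b hbC (har.trans hbr)) har hbr
    have hle : ∀ c ∈ C, ∀ d ∈ C, orbitCard Γ c ≤ orbitCard Γ d → c ≤ d := by
      intro c hc d hd h
      rcases h.lt_or_eq with h | h
      · exact (hlt c hc d hd h).le
      · exact (hinj hc hd h).le
    have hchain : IsChain (· ≤ ·) (insert z C) := by
      refine hC.1.insert fun c hc _ => ?_
      rcases lt_or_gt_of_ne (hne c hc) with h | h
      · exact Or.inr ((hle c hc a haC (ha c ⟨hc, h⟩)).trans haz.le)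
      · exact Or.inl (hzb.le.trans (hle b hbC c hc (hb c ⟨hc, h⟩)))
    have := hC.2 hchain (Set.subset_insert z C)
    exact hne z (this ▸ Set.mem_insert z C) hz
  rw [← hinj.ncard_image, himg, ← Finset.coe_Iic, Set.ncard_coe_finset,
    Nat.card_Iic]

/-- The chains are only weakly increasing by hypothesis, but cardinality grows by exactly one at
each step, which forces covering relations in the quotient. -/
theorem isSymmetricChainOrder_of_hasSymmChains
    (h : HasSymmChains (fun x : Finset α => 2 * (x.card : ℤ) - Fintype.card α)
      (fun x y => ∃ φ ∈ Γ, x.map φ.toEmbedding = y) Set.univ) :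
    IsSymmetricChainOrder (OrbitPoset (Γ.map (booleanAut α))) := by
  obtain ⟨ι, m, e, -, hρ, hm, hs, hi⟩ := h
  have hcard : ∀ i j, j ≤ m i → 2 * ((e i j).card : ℤ) - Fintype.card α = 2 * j - m i := hρ
  refine ⟨⟨Quotient.finite _, ⟨OrbitPoset.mk _ ∅, ?_⟩, fun C D hC hD => ?_⟩, ?_⟩
  · rintro ⟨x⟩
    exact OrbitPoset.mk_mono (Finset.empty_subset x)
  · rw [OrbitPoset.ncard_of_isMaxChain hC, OrbitPoset.ncard_of_isMaxChain hD]
  refine ⟨Set.range fun i => {a | ∃ j ≤ m i, OrbitPoset.mk _ (e i j) = a}, ⟨?_, ?_⟩, ?_⟩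
  · rintro ⟨i, h⟩
    have h0 : OrbitPoset.mk (Γ.map (booleanAut α)) (e i 0) ∈
        {a | ∃ j ≤ m i, OrbitPoset.mk (Γ.map (booleanAut α)) (e i j) = a} := ⟨0, Nat.zero_le _, rfl⟩
    exact (Set.ext_iff.1 h _).1 h0
  · rintro ⟨x⟩
    obtain ⟨i, j, hj, h⟩ := hs x trivial
    have hx := OrbitPoset.mk_booleanAut_eq_iff.2 h
    refine ⟨_, ⟨⟨i, rfl⟩, j, hj, hx.symm⟩, ?_⟩
    rintro _ ⟨⟨i', rfl⟩, j', hj', h'⟩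
    rw [hi i' j' i j hj' hj (OrbitPoset.mk_booleanAut_eq_iff.1 (h'.trans hx))]
  · rintro _ ⟨i, rfl⟩
    refine ⟨m i, fun j => OrbitPoset.mk _ (e i j), ?_, ?_, ?_⟩
    · ext a
      constructor
      · rintro ⟨j, rfl⟩
        exact ⟨j, Nat.lt_succ_iff.1 j.2, rfl⟩
      · rintro ⟨j, hj, rfl⟩
        exact ⟨⟨j, Nat.lt_succ_iff.2 hj⟩, rfl⟩
    · intro j
      have h1 := hcard i j j.2.le
      have h2 := hcard i (j + 1) j.2
      refine ⟨OrbitPoset.mk_lt_mk (hm i _ _ (Nat.le_succ _) j.2) ?_, fun c hc hc' => ?_⟩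
      · simp only [Fin.val_castSucc, Fin.val_succ]
        push_cast at h2
        omega
      · have h3 := orbitCard_strictMono hc
        have h4 := orbitCard_strictMono hc'
        rw [orbitCard_mk] at h3 h4
        simp only [Fin.val_castSucc, Fin.val_succ] at h3 h4
        push_cast at h2
        omega
    · rw [posetRankAt_eq_orbitCard, posetRankAt_eq_orbitCard, posetRank_eq_card, orbitCard_mk,
        orbitCard_mk]
      have h1 := hcard i 0 (Nat.zero_le _)
      have h2 := hcard i (m i) le_rfl
      simp only [Fin.val_zero, Fin.val_last]
      push_cast at h1
      norm_cast
      omega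

end BooleanQuotient

/-! ### Slices and the wreath product -/

section Wreath

variable {k t : ℕ}

/-- A set of subsets of `Fin k` that meets each orbit of `K` once and decomposes into symmetric
chains. -/
theorem exists_symmChain_transversal (K : Subgroup (Equiv.Perm (Fin k)))
    (hK : K = ⊤ ∨ K = alternatingGroup (Fin k)) :
    ∃ A : Set (Finset (Fin k)),
      HasSymmChains (fun x : Finset (Fin k) => 2 * (x.card : ℤ) - k) Eq A ∧
      (∀ x : Finset (Fin k), ∃ ρ ∈ K, x.map ρ.toEmbedding ∈ A) ∧
      ∀ x ∈ A, ∀ ρ ∈ K, x.map ρ.toEmbedding ∈ A → x.map ρ.toEmbedding = x := by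
  -- If `K` is transitive on subsets of each size, the initial segments form a single chain of
  -- representatives. The only exception is the trivial group `A_2`.
  by_cases hom : ∀ x y : Finset (Fin k), x.card = y.card → ∃ ρ ∈ K, x.map ρ.toEmbedding = y
  · let s : ℕ → Finset (Fin k) := fun j => Finset.univ.filter fun i => (i : ℕ) < j
    have hs : ∀ j ≤ k, (s j).card = j := fun j hj => by
      simp only [s]
      rw [Fin.card_filter_val_lt, min_eq_right hj]
    have hx : ∀ x : Finset (Fin k), x.card ≤ k := fun x => by
      simpa using Finset.card_le_univ x
    refine ⟨{x | ∃ j ≤ k, s j = x}, ⟨Unit, fun _ => k, fun _ => s, ?_, ?_, ?_, ?_, ?_⟩, ?_, ?_⟩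
    · exact fun _ j hj => ⟨j, hj, rfl⟩
    · intro _ j hj
      dsimp only
      rw [hs j hj]
    · intro _ j j' h _
      exact Finset.monotone_filter_right _ fun i _ hi => lt_of_lt_of_le hi h
    · rintro _ ⟨j, hj, rfl⟩
      exact ⟨(), j, hj, rfl⟩
    · exact fun _ _ _ _ _ _ _ => rfl
    · intro x
      obtain ⟨ρ, hρ, h⟩ := hom x (s x.card) (hs _ (hx x)).symm
      exact ⟨ρ, hρ, _, hx x, h.symm⟩
    · rintro _ ⟨j, hj, rfl⟩ ρ - ⟨j', hj', h⟩
      have hc := congrArg Finset.card h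
      rw [Finset.card_map, hs j hj, hs j' hj'] at hc
      rw [← h, hc]
  · have hK2 : K = alternatingGroup (Fin k) ∧ k < 3 := by
      by_contra hc
      refine hom fun x y hxy => ?_
      have tr : MulAction.IsPretransitive K (Set.powersetCard (Fin k) y.card) := by
        rcases hK with rfl | rfl
        · have := Set.powersetCard.isPretransitive (α := Fin k) (n := y.card)
          refine ⟨fun a b => ?_⟩
          obtain ⟨g, hg⟩ := this.exists_smul_eq a b
          exact ⟨⟨g, trivial⟩, hg⟩
        · exact Set.powersetCard.isPretransitive_alternatingGroup (by
            rw [Nat.card_fin]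
            exact not_lt.1 fun h => hc ⟨rfl, h⟩)
      obtain ⟨g, hg⟩ := tr.exists_smul_eq ⟨x, hxy⟩ ⟨y, rfl⟩
      refine ⟨g, g.2, ?_⟩
      have := congrArg Subtype.val hg
      rw [Finset.map_eq_image]
      exact this
    obtain ⟨rfl, hk⟩ := hK2
    have hk2 : k = 2 := by
      by_contra hk2
      refine hom fun x y hxy => ⟨1, Subgroup.one_mem _, ?_⟩
      have h1 : k < 2 := by omega
      have : x = y := by
        clear hom
        interval_cases k <;> revert x y <;> decide
      rw [this]
      exact Finset.map_refl
    subst hk2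
    have hbot : ∀ ρ ∈ alternatingGroup (Fin 2), ρ = 1 := by
      intro ρ hρ
      rw [Equiv.Perm.mem_alternatingGroup] at hρ
      revert ρ
      decide
    -- For `k = 2` all four subsets are kept, in the chains `∅, {0}, {0, 1}` and `{1}`.
    refine ⟨Set.univ, ⟨Bool, fun b => cond b 2 0, fun b j => cond b
      (Finset.univ.filter fun i => (i : ℕ) < j) {1}, ?_, ?_, ?_, ?_, ?_⟩, ?_, ?_⟩
    · exact fun _ _ _ => trivial
    · rintro (_ | _) j hj <;> simp only [cond] at hj ⊢ <;> interval_cases j <;> decide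
    · rintro (_ | _) j j' h hj'
      · exact le_rfl
      · exact Finset.monotone_filter_right _ fun i _ hi => lt_of_lt_of_le hi h
    · intro x _
      have hx : x = ∅ ∨ x = {0} ∨ x = {1} ∨ x = Finset.univ := by
        revert x
        decide
      rcases hx with rfl | rfl | rfl | rfl
      · exact ⟨true, 0, by decide, by decide⟩
      · exact ⟨true, 1, by decide, by decide⟩
      · exact ⟨false, 0, by decide, by decide⟩
      · exact ⟨true, 2, by decide, by decide⟩
    · rintro (_ | _) j (_ | _) j' hj hj' h <;> simp only [cond] at hj hj' h ⊢
      · interval_cases j' <;> revert h <;> decide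
      · interval_cases j <;> revert h <;> decide
    · exact fun x => ⟨1, Subgroup.one_mem _, trivial⟩
    · intro x _ ρ hρ _
      rw [hbot ρ hρ]
      exact Finset.map_refl

/-- The subset of `Fin k × Fin t` with given slices. -/
def ofSlices (f : Fin t → Finset (Fin k)) : Finset (Fin k × Fin t) :=
  Finset.univ.filter fun p => p.1 ∈ f p.2

theorem mem_ofSlices {f : Fin t → Finset (Fin k)} {i : Fin k} {r : Fin t} :
    (i, r) ∈ ofSlices f ↔ i ∈ f r := by
  simp [ofSlices]

theorem card_ofSlices (f : Fin t → Finset (Fin k)) :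
    (ofSlices f).card = ∑ r, (f r).card := by
  rw [ofSlices, Finset.card_filter, Fintype.sum_prod_type_right]
  simp

theorem ofSlices_map_eq_iff {f f' : Fin t → Finset (Fin k)}
    {φ : Equiv.Perm (Fin k × Fin t)} {ρ : Fin t → Equiv.Perm (Fin k)} {τ : Equiv.Perm (Fin t)}
    (hφ : ∀ i r, φ (i, r) = (ρ r i, τ r)) :
    (ofSlices f).map φ.toEmbedding = ofSlices f' ↔
      ∀ r, (f r).map (ρ r).toEmbedding = f' (τ r) := by
  have key : ∀ i r, φ (i, r) ∈ (ofSlices f).map φ.toEmbedding ↔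
      ρ r i ∈ (f r).map (ρ r).toEmbedding := fun i r => by
    rw [← Equiv.coe_toEmbedding, Finset.mem_map', mem_ofSlices, ← Equiv.coe_toEmbedding,
      Finset.mem_map']
  constructor
  · intro h r
    ext j
    obtain ⟨i, rfl⟩ := (ρ r).surjective j
    rw [← key, h, hφ, mem_ofSlices]
  · intro h
    ext p
    obtain ⟨⟨i, r⟩, rfl⟩ := φ.surjective p
    rw [key, h, hφ, mem_ofSlices]

/-- Acting by `K` in each slice moves all slices into the transversal `A`; between such subsets,
only the permutation of slices by `T` remains. -/
theorem hasSymmChains_wreath (K : Subgroup (Equiv.Perm (Fin k)))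
    (hK : K = ⊤ ∨ K = alternatingGroup (Fin k))
    (T : Subgroup (Equiv.Perm (Fin t))) (hT : GeneratedByPowersOfDisjointCycles T) :
    HasSymmChains
      (fun x : Finset (Fin k × Fin t) => 2 * (x.card : ℤ) - Fintype.card (Fin k × Fin t))
      (fun x y => ∃ φ ∈ wreathSubgroup K T, x.map φ.toEmbedding = y) Set.univ := by
  obtain ⟨A, hA, hex, huniq⟩ := exists_symmChain_transversal K hK
  refine (HasSymmChains.fun_of_generatedByPowersOfDisjointCycles hT hA).map ofSlices
    ?_ (fun _ _ => trivial) ?_ ?_ ?_ ?_ ?_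
  · rintro x y z ⟨φ, hφ, rfl⟩ ⟨ψ, hψ, rfl⟩
    refine ⟨ψ * φ, Subgroup.mul_mem _ hψ hφ, ?_⟩
    rw [Finset.map_map]
    rfl
  · intro f _
    rw [card_ofSlices, Finset.sum_sub_distrib, ← Finset.mul_sum]
    simp [mul_comm]
  · intro f _ f' _ h p hp
    rw [← Prod.mk.eta (p := p), mem_ofSlices] at hp ⊢
    exact h _ hp
  · rintro f - f' - ⟨⟨τ, hτ⟩, h⟩
    refine ⟨(Equiv.refl _).prodCongr τ⁻¹,
      ⟨fun _ => 1, τ⁻¹, fun _ => K.one_mem, T.inv_mem hτ, fun _ _ => rfl⟩,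
      (ofSlices_map_eq_iff (ρ := fun _ => 1) (τ := τ⁻¹) fun _ _ => rfl).2 fun r => ?_⟩
    rw [h, Subgroup.smul_def, Equiv.Perm.smul_def, show τ (τ⁻¹ r) = r from τ.apply_symm_apply r]
    exact Finset.map_refl
  · intro x _
    choose ρ hρ hρA using fun r : Fin t => hex (Finset.univ.filter fun i => (i, r) ∈ x)
    have hx : ofSlices (fun r => Finset.univ.filter fun i => (i, r) ∈ x) = x := by
      ext ⟨i, r⟩
      simp [mem_ofSlices]
    let φ : Equiv.Perm (Fin k × Fin t) :=
      ⟨fun p => (ρ p.2 p.1, p.2), fun p => ((ρ p.2).symm p.1, p.2), fun p => by simp,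
        fun p => by simp⟩
    refine ⟨_, hρA, φ, ⟨ρ, 1, hρ, T.one_mem, fun _ _ => rfl⟩, ?_⟩
    conv_lhs => rw [← hx]
    exact (ofSlices_map_eq_iff (ρ := ρ) (τ := 1) fun _ _ => rfl).2 fun r => rfl
  · rintro f hf f' hf' ⟨φ, ⟨ρ, τ, hρ, hτ, hφ⟩, h⟩
    rw [ofSlices_map_eq_iff hφ] at h
    refine ⟨⟨τ⁻¹, T.inv_mem hτ⟩, fun r => ?_⟩
    rw [Subgroup.smul_def, Equiv.Perm.smul_def]
    have h1 := h (τ⁻¹ r)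
    rw [show τ (τ⁻¹ r) = r from τ.apply_symm_apply r] at h1
    -- Both slices lie in `A` and in the same `K`-orbit, hence coincide.
    rw [← h1, huniq _ (hf _) _ (hρ _) (h1 ▸ hf' r)]

end Wreath

theorem mainTheorem3 (k t : ℕ) (hk : 0 < k) (ht : 0 < t)
    (K : Subgroup (Equiv.Perm (Fin k))) (hK : K = ⊤ ∨ K = alternatingGroup (Fin k))
    (T : Subgroup (Equiv.Perm (Fin t))) (hT : GeneratedByPowersOfDisjointCycles T) :
    IsSymmetricChainOrder
      (OrbitPoset ((wreathSubgroup K T).map (booleanAut (Fin k × Fin t)))) := by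
  exact isSymmetricChainOrder_of_hasSymmChains (hasSymmChains_wreath K hK T hT)
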